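/- Let $n\ge 2$ and $k\in\mathbb N\cup\{\infty\}$. Let $U\subset\mathbb R^{n+1}$ be an open set, star-shaped about the origin $O\in U$, with coordinates $y^0,\dots,y^n$, and let $C$ be a Lorentzian metric on $U$ with components of class $C^{k+1}$, for which the $y^\mu$ are normal coordinates centred at $O$: $C(O)=\eta=\mathrm{diag}(-1,1,\dots,1)$ and the straight lines through $O$ are affinely parametrized geodesics of $C$. Let $C_O=\{y^0=|\vec y|\}$ be the light-cone of $O$, parametrized by $y^0=r$, $y^i=r\Theta^i$ with $\Theta\in S^{n-1}$, let $x^A$ be local coordinates on $S^{n-1}$, and let $$\gamma_{AB}=r^2\,C_{ij}|_{C_O}\,\frac{\partial\Theta^i}{\partial x^A}\frac{\partial\Theta^j}{\partial x^B}$$ be the tensor induced by $C$ on $C_O$. Let $\sigma_A{}^C$ be the traceless part of $\tfrac12\gamma^{BC}\partial_r\gamma_{AB}$, and $|\sigma|^2=\sigma_A{}^B\sigma_B{}^A$. Let $\kappa$ be a function on $C_O\cap U\setminus\{O\}$ such that $r\kappa$ is the restriction to $C_O$ of a $C^k$ function $f$ on $U$ with $f(y)=O(|y|^2)$ as $y\to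 O$. For an open set $V\subset U$, star-shaped about $O\in V$, we call conformal factor on $V$ a positive function $\Omega$ on $C_O\cap V\setminus\{O\}$, differentiable in $r$, which tends to $1$ as $r\to0$ along each generator of $C_O$, and such that the divergence $\tau=\tfrac12 g^{AB}\partial_r g_{AB}$ of $g_{AB}=\Omega^2\gamma_{AB}$ is differentiable in $r$ and solves the vacuum Raychaudhuri equation $$\partial_r\tau-\kappa\tau+\frac{\tau^2}{n-1}+|\sigma|^2=0 .$$ Then there is such a set $V$ on which a conformal factor exists. Moreover, for every such $V$ and every conformal factor $\Omega$ on $V$, the function $\Omega^2$ is the restriction to $C_O\cap V\setminus\{O\}$ of a $C^k$ function $F$ on $V$ with $F(O)=1$, and $\Omega$ is the only conformal factor on $V$. -/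

import Mathlib

open Filter Topology Asymptotics

noncomputable section

namespace LightCone

/-- Space-time `ℝ^{n+1}` with coordinates `y^0, y^1, …, y^n`; the index `0` is time and the index
`i.succ`, with `i : Fin n`, is the `i`-th space coordinate. -/
abbrev Spacetime (n : ℕ) : Type := Fin (n + 1) → ℝ

/-- The components `C_{μν}(y)` of a tensor field in the coordinates `y`. -/
abbrev TensorField (n : ℕ) : Type := Spacetime n → Matrix (Fin (n + 1)) (Fin (n + 1)) ℝ

/-- The Minkowski metric `η = diag(-1, 1, …, 1)`. -/
def minkowski (n : ℕ) : Matrix (Fin (n + 1)) (Fin (n + 1)) ℝ :=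
  Matrix.diagonal (Fin.cons (-1) fun _ => 1)

/-- A symmetric matrix of signature `(-, +, …, +)`: one congruent to `η`. -/
def IsLorentzian {n : ℕ} (M : Matrix (Fin (n + 1)) (Fin (n + 1)) ℝ) : Prop :=
  ∃ P : Matrix (Fin (n + 1)) (Fin (n + 1)) ℝ, IsUnit P.det ∧ P.transpose * M * P = minkowski n

/-- `C` is a Lorentzian metric with `C^m` components on `U`. -/
structure IsMetricOn {n : ℕ} (m : ℕ∞) (C : TensorField n) (U : Set (Spacetime n)) : Prop where
  lorentzian : ∀ y ∈ U, IsLorentzian (C y)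
  contDiffOn : ∀ μ ν, ContDiffOn ℝ m (fun y => C y μ ν) U

/-- The partial derivative `∂_μ f` at `y`. -/
def partialDeriv {n : ℕ} (μ : Fin (n + 1)) (f : Spacetime n → ℝ) (y : Spacetime n) : ℝ :=
  fderiv ℝ f y (Pi.single μ 1)

/-- The Christoffel symbol `Γ^l_{a b}` of `C`. -/
def christoffel {n : ℕ} (C : TensorField n) (y : Spacetime n) (l a b : Fin (n + 1)) : ℝ :=
  1 / 2 * ∑ ν, (C y)⁻¹ l ν *
    (partialDeriv a (fun z => C z ν b) y + partialDeriv b (fun z => C z ν a) y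
      - partialDeriv ν (fun z => C z a b) y)

/-- The coordinates `y` on `U` (a star-shaped neighbourhood of the origin) are normal coordinates
for `C` centred at the origin: they are orthonormal at the origin, and each straight line
`t ↦ t v` through the origin satisfies the geodesic equation
`c''^l + Γ^l_{a b}(c) c'^a c'^b = 0` as long as it is in `U` (its second derivative vanishes). -/
structure IsNormalOn {n : ℕ} (C : TensorField n) (U : Set (Spacetime n)) : Prop where
  at_origin : C 0 = minkowski n
  geodesic : ∀ (v : Spacetime n) (t : ℝ), t • v ∈ U →
    ∀ l, ∑ a, ∑ b, christoffel C (t • v) l a b * v a * v b = 0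

/-- The light-cone `C_O = {y^0 = |(y^1, …, y^n)|}`. -/
def cone (n : ℕ) : Set (Spacetime n) :=
  {y | y 0 = Real.sqrt (∑ i : Fin n, y i.succ ^ 2)}

/-- The point `y^0 = r`, `y^i = r Θ^i` of the light-cone, with `Θ` in the unit sphere. -/
def conePoint {n : ℕ} (r : ℝ) (Θ : Fin n → ℝ) : Spacetime n :=
  Fin.cons r fun i => r * Θ i

/-- `e` is the coordinate frame `e_A = ∂Θ/∂x^A` at the point `Θ` of the unit sphere `S^{n-1}`, for
some local coordinates `x^A`, that is to say, a basis of the tangent space of the sphere at `Θ`. -/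
structure IsFrame {n : ℕ} (Θ : Fin n → ℝ) (e : Fin (n - 1) → Fin n → ℝ) : Prop where
  unit : ∑ i, Θ i ^ 2 = 1
  tangent : ∀ A, ∑ i, e A i * Θ i = 0
  linearIndependent : LinearIndependent ℝ e

/-- The tensor induced by `C` on the light-cone,
`γ_{AB}(r) = r² C_{ij} ∂_A Θ^i ∂_B Θ^j`, along the generator through `Θ`. -/
def inducedMetric {n : ℕ} (C : TensorField n) (Θ : Fin n → ℝ) (e : Fin (n - 1) → Fin n → ℝ)
    (r : ℝ) : Matrix (Fin (n - 1)) (Fin (n - 1)) ℝ :=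
  Matrix.of fun A B =>
    r ^ 2 * ∑ i : Fin n, ∑ j : Fin n, C (conePoint r Θ) i.succ j.succ * e A i * e B j

/-- `½ h^{BC} ∂_r h_{AB}`, with row index `A` and column index `C`. -/
def halfLogDeriv {d : ℕ} (h : ℝ → Matrix (Fin d) (Fin d) ℝ) (r : ℝ) : Matrix (Fin d) (Fin d) ℝ :=
  (1 / 2 : ℝ) • (Matrix.of (fun A B => deriv (fun s => h s A B) r) * (h r)⁻¹)

/-- The divergence `τ = ½ h^{AB} ∂_r h_{AB}`. -/
def divergence {d : ℕ} (h : ℝ → Matrix (Fin d) (Fin d) ℝ) (r : ℝ) : ℝ :=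
  (halfLogDeriv h r).trace

/-- The traceless part `σ_A^C` of `½ h^{BC} ∂_r h_{AB}`. -/
def shear {d : ℕ} (h : ℝ → Matrix (Fin d) (Fin d) ℝ) (r : ℝ) : Matrix (Fin d) (Fin d) ℝ :=
  halfLogDeriv h r - ((halfLogDeriv h r).trace / (d : ℝ)) • (1 : Matrix (Fin d) (Fin d) ℝ)

/-- `|σ|² = σ_A^B σ_B^A`. -/
def shearSq {d : ℕ} (h : ℝ → Matrix (Fin d) (Fin d) ℝ) (r : ℝ) : ℝ :=
  (shear h r * shear h r).trace

/-- The rescaled tensor `g_{AB} = Ω² γ_{AB}` along the generator through `Θ`. -/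
def rescaledMetric {n : ℕ} (C : TensorField n) (Ω : Spacetime n → ℝ) (Θ : Fin n → ℝ)
    (e : Fin (n - 1) → Fin n → ℝ) (r : ℝ) : Matrix (Fin (n - 1)) (Fin (n - 1)) ℝ :=
  Ω (conePoint r Θ) ^ 2 • inducedMetric C Θ e r

/-- `Ω` is a conformal factor on the part of the light-cone in `V`, vertex excluded, obtained by
solving the vacuum Raychaudhuri equation `∂_r τ - κ τ + τ² / (n - 1) + |σ|² = 0`, where `τ` is the
divergence of `g_{AB} = Ω² γ_{AB}` and `σ` is the shear of `γ_{AB}`, with `Ω = 1` at `r = 0` on each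
generator. Only the values of `κ` and `Ω` on the light-cone without its vertex matter. -/
structure IsConformalFactor {n : ℕ} (C : TensorField n) (κ : Spacetime n → ℝ)
    (V : Set (Spacetime n)) (Ω : Spacetime n → ℝ) : Prop where
  pos : ∀ y ∈ cone n ∩ V, y ≠ 0 → 0 < Ω y
  tendsto_one : ∀ Θ : Fin n → ℝ, ∑ i, Θ i ^ 2 = 1 →
    Tendsto (fun r => Ω (conePoint r Θ)) (𝓝[>] 0) (𝓝 1)
  differentiableAt : ∀ Θ : Fin n → ℝ, ∑ i, Θ i ^ 2 = 1 → ∀ r : ℝ, 0 < r → conePoint r Θ ∈ V →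
    DifferentiableAt ℝ (fun s => Ω (conePoint s Θ)) r
  raychaudhuri : ∀ Θ e, IsFrame Θ e → ∀ r : ℝ, 0 < r → conePoint r Θ ∈ V →
    ∃ τ' : ℝ, HasDerivAt (divergence (rescaledMetric C Ω Θ e)) τ' r ∧
      τ' - κ (conePoint r Θ) * divergence (rescaledMetric C Ω Θ e) r
        + divergence (rescaledMetric C Ω Θ e) r ^ 2 / ((n : ℝ) - 1)
        + shearSq (inducedMetric C Θ e) r = 0

end LightCone

end

noncomputable section

namespace LightCone

/-! Along a generator the Raychaudhuri equation is a Riccati equation for `τ`. Putting `τ = (n - 1)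
u' / u` makes it linear: `u'' = κ u' - |σ|² u / (n - 1)`. With `L = ½ C⁻¹ ∂_r C`, one such `u` is `r
Ω exp ((n - 1)⁻¹ ∫ tr L)`, and the condition `Ω → 1` becomes `u / r → 1`.

The difficulty is regularity at the vertex, where `(r, Θ)` are singular. The generator ending at `y`
is rescaled to `[0, 1]`, giving `φ'' = a φ' - b φ`, `φ(0) = 0`, `φ'(0) = 1`, where `a(t) = f(t y) /
t` and `b` comes from the traces of `L` and `L²`. Traces over the screen space can be replaced by
traces over spacetime (`IsFrame.trace_eq`), because the Gauss lemma `C(y) y = η y` (`gauss_lemma`)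
makes `∂_r C` annihilate the null direction. So `a` and `b` are defined for every `y ∈ U`, on the
cone or off it, and they are `C^k` in `y` as elements of the Banach space `C([0, 1])`
(`contDiffOn_rayMap`, `contDiffOn_rayQuotient`). The solution depends smoothly on `(a, b)`, being
obtained by inverting an operator (`contDiff_velocity`). Hence `φ(1) exp (-(n - 1)⁻¹ ∫ tr L)` is a
`C^k` function of `y`, called `conformalExtension`.

Every conformal factor agrees with this function on the cone, by a uniqueness theorem which assumes
nothing on `u'` at the vertex (`extend_position_eq_of_ode`). Conversely `φ'` is close to `1` for `y`
near `O`, so `φ` is positive there and the function is a conformal factor. -/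

theorem continuousOn_mkD {E F : Type*} [TopologicalSpace E] [NormedAddCommGroup F]
    {U : Set E} {h : E → unitInterval → F}
    (hh : ContinuousOn (fun p : E × unitInterval => h p.1 p.2) (U ×ˢ Set.univ)) :
    ContinuousOn (fun y => ContinuousMap.mkD (h y) 0) U ∧
      ∀ y ∈ U, ∀ t, ContinuousMap.mkD (h y) 0 t = h y t := by
  have h1 : Continuous fun p : U × unitInterval => h p.1 p.2 :=
    hh.comp_continuous (f := fun p : U × unitInterval => ((p.1 : E), p.2)) (by fun_prop)
      fun p => ⟨p.1.2, trivial⟩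
  have h2 : ∀ y ∈ U, Continuous (h y) := fun y hy =>
    h1.comp (f := fun t => ((⟨y, hy⟩ : U), t)) (by fun_prop)
  -- The default `0` of `mkD` serves only discontinuous paths, which cannot occur over `U`.
  have h3 : ∀ y ∈ U, ∀ t, ContinuousMap.mkD (h y) 0 t = h y t := fun y hy t => by
    rw [ContinuousMap.mkD_of_continuous (h2 y hy)]; rfl
  refine ⟨continuousOn_iff_continuous_domRestrict.2 ?_, h3⟩
  -- Currying is continuous for the compact-open topology, which on the compact interval is that of
  -- the sup norm.
  refine ContinuousMap.continuous_of_continuous_uncurry _ ?_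
  refine h1.congr fun p => ?_
  exact (h3 p.1 p.1.2 p.2).symm

/-! ### Functions restricted to segments from the origin, as points of `C([0, 1])` -/

section RayMap

variable {E F : Type*} [NormedAddCommGroup E] [NormedSpace ℝ E]
  [NormedAddCommGroup F] [NormedSpace ℝ F]

/-- Evaluation of a path of linear maps, weighted by a scalar function, as an operator with values
in the continuous functions on the unit interval. -/
def pathApply (w : C(unitInterval, ℝ)) :
    C(unitInterval, E →L[ℝ] F) →L[ℝ] E →L[ℝ] C(unitInterval, F) :=
  LinearMap.mkContinuous₂
    (LinearMap.mk₂ ℝ (fun (m : C(unitInterval, E →L[ℝ] F)) (v : E) =>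
        (⟨fun t => w t • m t v, by fun_prop⟩ : C(unitInterval, F)))
      (fun m m' v => by ext t; simp) (fun c m v => by ext t; simpa using smul_comm (w t) c (m t v))
      (fun m v v' => by ext t; simp) (fun c m v => by ext t; simpa using smul_comm (w t) c (m t v)))
    ‖w‖ (fun m v => by
      refine (ContinuousMap.norm_le _ (by positivity)).2 fun t => ?_
      simp only [LinearMap.mk₂_apply, ContinuousMap.coe_mk, norm_smul]
      rw [mul_assoc]
      have h1 := w.norm_coe_le_norm t
      have h2 := (m t).le_of_opNorm_le (m.norm_coe_le_norm t) v
      gcongr)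

@[simp]
theorem pathApply_apply (w : C(unitInterval, ℝ)) (m : C(unitInterval, E →L[ℝ] F)) (v : E)
    (t : unitInterval) : pathApply w m v t = w t • m t v := rfl

/-- A family of continuous functions on the unit interval that is pointwise differentiable with
respect to a parameter, with a derivative depending continuously on the parameter, uniformly on the
interval, is differentiable in the sup norm. -/
theorem hasFDerivAt_of_pointwise {U : Set E} (hU : IsOpen U) (w : C(unitInterval, ℝ))
    {G : E → C(unitInterval, F)} {G' : E → C(unitInterval, E →L[ℝ] F)}
    (hG : ∀ y ∈ U, ∀ t, HasFDerivAt (fun z => G z t) (w t • G' y t) y)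
    (hG' : ContinuousOn G' U) {y : E} (hy : y ∈ U) :
    HasFDerivAt G (pathApply w (G' y)) y := by
  rw [hasFDerivAt_iff_isLittleO, Asymptotics.isLittleO_iff]
  intro c hc
  have hcont := (hG'.continuousAt (hU.mem_nhds hy))
  -- After multiplication by `w t` this tolerance stays below `c`; the `+ 1` covers `w = 0`.
  have hc' : 0 < c / (‖w‖ + 1) := by positivity
  obtain ⟨δ, hδ, hball⟩ := Metric.mem_nhds_iff.1
    (Filter.inter_mem (hcont.tendsto.eventually (Metric.ball_mem_nhds (G' y) hc')) (hU.mem_nhds hy))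
  filter_upwards [Metric.ball_mem_nhds y hδ] with z hz
  refine (ContinuousMap.norm_le _ (by positivity)).2 fun t => ?_
  -- Mean value inequality on the ball. The radius `δ` does not depend on `t`, since `G'` is
  -- continuous in the sup norm.
  have key := Convex.norm_image_sub_le_of_norm_hasFDerivWithin_le' (𝕜 := ℝ)
    (f := fun z => G z t) (f' := fun z => w t • G' z t) (φ := w t • G' y t) (C := c)
    (s := Metric.ball y δ) (fun x hx => (hG x (hball hx).2 t).hasFDerivWithinAt)
    (fun x hx => ?_) (convex_ball y δ) (Metric.mem_ball_self hδ) hz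
  · simpa [smul_sub] using key
  · have h1 : ‖G' x - G' y‖ < c / (‖w‖ + 1) := by
      have : dist (G' x) (G' y) < _ := (hball hx).1
      exact (dist_eq_norm (G' x) (G' y)).symm.trans_lt this
    have h2 := (G' x - G' y).norm_coe_le_norm t
    rw [← smul_sub, norm_smul]
    have h3 := w.norm_coe_le_norm t
    rw [ContinuousMap.sub_apply] at h2
    calc ‖w t‖ * ‖G' x t - G' y t‖ ≤ (‖w‖ + 1) * (c / (‖w‖ + 1)) := by
          gcongr
          · linarith
          · linarith
      _ = c := by field_simp

/-- The restriction `t ↦ g (t y)` of `g` to the segment from the origin to `y`. -/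
def rayMap {F : Type*} [NormedAddCommGroup F] (g : E → F) (y : E) : C(unitInterval, F) :=
  ContinuousMap.mkD (fun t : unitInterval => g ((t : ℝ) • y)) 0

/-- The function `t ↦ g (t y) / t` on the unit interval. -/
def rayQuotient (g : E → F) (y : E) : C(unitInterval, F) :=
  ContinuousMap.mkD (fun t : unitInterval => (t : ℝ)⁻¹ • g ((t : ℝ) • y)) 0

theorem smul_mem_of_unitInterval {U : Set E} (hs : StarConvex ℝ 0 U) {y : E} (hy : y ∈ U)
    (t : unitInterval) : (t : ℝ) • y ∈ U :=
  hs.smul_mem hy t.2.1 t.2.2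

theorem rayMap_spec {F : Type*} [NormedAddCommGroup F] {U : Set E} (hs : StarConvex ℝ 0 U)
    {g : E → F} (hg : ContinuousOn g U) :
    ContinuousOn (rayMap g) U ∧ ∀ y ∈ U, ∀ t : unitInterval, rayMap g y t = g ((t : ℝ) • y) :=
  continuousOn_mkD (h := fun y t => g ((t : ℝ) • y)) <|
    hg.comp (f := fun p : E × unitInterval => (p.2 : ℝ) • p.1) (by fun_prop)
      fun p hp => smul_mem_of_unitInterval hs hp.1 p.2

theorem rayQuotient_spec {U : Set E} (hU : IsOpen U) (hs : StarConvex ℝ 0 U) {g : E → F}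
    (hg : ContinuousOn g U) (hg0 : g =O[𝓝 0] fun y => ‖y‖ ^ 2) :
    ContinuousOn (rayQuotient g) U ∧
      ∀ y ∈ U, ∀ t : unitInterval, rayQuotient g y t = (t : ℝ)⁻¹ • g ((t : ℝ) • y) := by
  refine continuousOn_mkD (h := fun y (t : unitInterval) => (t : ℝ)⁻¹ • g ((t : ℝ) • y)) ?_
  rintro ⟨y, t⟩ ⟨hy, -⟩
  refine ContinuousAt.continuousWithinAt ?_
  have hmul : ContinuousAt (fun p : E × unitInterval => (p.2 : ℝ) • p.1) (y, t) := by fun_prop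
  -- At `t = 0` the convention `0⁻¹ = 0` gives the value `0`, which is the right limit: `‖g(t y) /
  -- t‖ ≤ c |t| ‖y‖²`.
  by_cases ht : (t : ℝ) = 0
  · obtain ⟨c, hc⟩ := hg0.bound
    have h0 : Tendsto (fun p : E × unitInterval => (p.2 : ℝ) • p.1) (𝓝 (y, t)) (𝓝 0) := by
      have := hmul.tendsto; simpa [ht] using this
    have hlim : Tendsto (fun p : E × unitInterval => |(p.2 : ℝ)| * (c * ‖p.1‖ ^ 2)) (𝓝 (y, t))
        (𝓝 0) := by
      have : ContinuousAt (fun p : E × unitInterval => |(p.2 : ℝ)| * (c * ‖p.1‖ ^ 2)) (y, t) := by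
        fun_prop
      have := this.tendsto; simpa [ht] using this
    rw [ContinuousAt]
    simp only [ht, inv_zero, zero_smul]
    refine squeeze_zero_norm' ?_ hlim
    filter_upwards [h0.eventually hc] with p hp
    rcases eq_or_ne (p.2 : ℝ) 0 with h | h
    · simp [h]
    · rw [norm_smul, norm_inv, Real.norm_eq_abs]
      have hpos : 0 < |(p.2 : ℝ)| := abs_pos.2 h
      rw [inv_mul_le_iff₀ hpos]
      refine hp.trans (le_of_eq ?_)
      rw [norm_pow, norm_norm, norm_smul, Real.norm_eq_abs]; ring
  · refine ContinuousAt.smul (ContinuousAt.inv₀ (by fun_prop) ht) ?_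
    exact ContinuousAt.comp (f := fun p : E × unitInterval => (p.2 : ℝ) • p.1)
      (hg.continuousAt (hU.mem_nhds (smul_mem_of_unitInterval hs hy t))) hmul

end RayMap

/-! ### Regularity of the ray maps -/

section Smooth

universe u

variable {E : Type u} [NormedAddCommGroup E] [NormedSpace ℝ E]

theorem hasFDerivAt_comp_smul {F : Type*} [NormedAddCommGroup F] [NormedSpace ℝ F] {g : E → F}
    {y : E} (c : ℝ) (hg : DifferentiableAt ℝ g (c • y)) :
    HasFDerivAt (fun z => g (c • z)) (c • fderiv ℝ g (c • y)) y := by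
  have h1 : HasFDerivAt (fun z : E => c • z) (c • ContinuousLinearMap.id ℝ E) y :=
    (hasFDerivAt_id y).const_smul c
  have := hg.hasFDerivAt.comp y h1
  convert! this using 1
  ext v
  simp

/-- The derivative at `y` is `v ↦ (t ↦ t g'(t y) v)`, a fixed continuous linear image of the ray map
of `g'`. The induction therefore replaces `F` by `E →L[ℝ] F`, so `F` is quantified inside it and
lives in the universe of `E`. -/
theorem contDiffOn_rayMap_nat {U : Set E} (hU : IsOpen U) (hs : StarConvex ℝ 0 U) (k : ℕ) :
    ∀ {F : Type u} [NormedAddCommGroup F] [NormedSpace ℝ F] {g : E → F},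
      ContDiffOn ℝ k g U → ContDiffOn ℝ k (rayMap g) U := by
  induction k with
  | zero =>
    intro F _ _ g hg
    simp only [Nat.cast_zero, contDiffOn_zero] at hg ⊢
    exact (rayMap_spec hs hg).1
  | succ k ih =>
    intro F _ _ g hg
    push_cast at hg ⊢
    have hg' := (contDiffOn_succ_iff_fderiv_of_isOpen hU).1 hg
    have hspec := (rayMap_spec hs hg.continuousOn).2
    have hspec' := rayMap_spec hs hg'.2.2.continuousOn
    have hder : ∀ y ∈ U, HasFDerivAt (rayMap g)
        (pathApply ⟨fun t : unitInterval => (t : ℝ), by fun_prop⟩ (rayMap (fderiv ℝ g) y)) y :=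
      fun y hy => hasFDerivAt_of_pointwise hU _ (fun z hz t => by
        have hz' := smul_mem_of_unitInterval hs hz t
        have h1 := hasFDerivAt_comp_smul (t : ℝ) (hg'.1.differentiableAt (hU.mem_nhds hz'))
        rw [hspec'.2 z hz t]
        refine h1.congr_of_eventuallyEq ?_
        filter_upwards [hU.mem_nhds hz] with x hx using hspec x hx t) hspec'.1 hy
    refine (contDiffOn_succ_iff_fderiv_of_isOpen hU).2
      ⟨fun y hy => (hder y hy).differentiableAt.differentiableWithinAt, by simp, ?_⟩
    refine ContDiffOn.congr ?_ fun y hy => (hder y hy).fderiv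
    exact (ContinuousLinearMap.contDiff _).comp_contDiffOn (ih hg'.2.2)

theorem contDiffOn_rayMap {U : Set E} (hU : IsOpen U) (hs : StarConvex ℝ 0 U) (k : ℕ∞)
    {F : Type u} [NormedAddCommGroup F] [NormedSpace ℝ F] {g : E → F}
    (hg : ContDiffOn ℝ k g U) : ContDiffOn ℝ k (rayMap g) U :=
  contDiffOn_iff_forall_nat_le.2 fun m hm =>
    contDiffOn_rayMap_nat hU hs m (hg.of_le (by exact_mod_cast hm))

theorem hasFDerivAt_zero_of_isBigO_sq {F : Type*} [NormedAddCommGroup F] [NormedSpace ℝ F] {g : E → F}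
    (hg0 : g =O[𝓝 0] fun y => ‖y‖ ^ 2) : HasFDerivAt g (0 : E →L[ℝ] F) 0 := by
  have h0 : g 0 = 0 := by
    obtain ⟨c, hc⟩ := hg0.bound
    simpa using hc.self_of_nhds
  rw [hasFDerivAt_iff_isLittleO]
  simp only [h0, sub_zero, _root_.zero_apply]
  exact hg0.trans_isLittleO (isLittleO_norm_pow_id one_lt_two)

/-- One differentiation cancels the factor `1 / t`: the derivative is the ray map of `g'`, so no
order of differentiability is lost. -/
theorem contDiffOn_rayQuotient {U : Set E} (hU : IsOpen U)
    (hs : StarConvex ℝ 0 U) (k : ℕ∞)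
    {F : Type u} [NormedAddCommGroup F] [NormedSpace ℝ F] {g : E → F}
    (hg : ContDiffOn ℝ k g U) (hg0 : g =O[𝓝 0] fun y => ‖y‖ ^ 2) :
    ContDiffOn ℝ k (rayQuotient g) U := by
  refine contDiffOn_iff_forall_nat_le.2 fun m hm => ?_
  replace hg : ContDiffOn ℝ m g U := hg.of_le (by exact_mod_cast hm)
  have hspec := rayQuotient_spec hU hs hg.continuousOn hg0
  cases m with
  | zero => simpa using hspec.1
  | succ m =>
    push_cast at hg ⊢
    have hg' := (contDiffOn_succ_iff_fderiv_of_isOpen hU).1 hg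
    have hspec' := rayMap_spec hs hg'.2.2.continuousOn
    have hder : ∀ y ∈ U, HasFDerivAt (rayQuotient g)
        (pathApply 1 (rayMap (fderiv ℝ g) y)) y :=
      fun y hy => hasFDerivAt_of_pointwise hU _ (fun z hz t => by
        have hz' := smul_mem_of_unitInterval hs hz t
        have h1 := (hasFDerivAt_comp_smul (t : ℝ)
          (hg'.1.differentiableAt (hU.mem_nhds hz'))).const_smul (t : ℝ)⁻¹
        have h2 : (t : ℝ)⁻¹ • (t : ℝ) • fderiv ℝ g ((t : ℝ) • z)
            = (1 : C(unitInterval, ℝ)) t • rayMap (fderiv ℝ g) z t := by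
          rw [hspec'.2 z hz t]
          -- At `t = 0` the left side is `0` by convention and the right side is `g'(0)`, which
          -- vanishes by the quadratic bound.
          rcases eq_or_ne (t : ℝ) 0 with h | h
          · simp [h, (hasFDerivAt_zero_of_isBigO_sq hg0).fderiv]
          · simp [smul_smul, inv_mul_cancel₀ h]
        rw [← h2]
        refine h1.congr_of_eventuallyEq ?_
        filter_upwards [hU.mem_nhds hz] with x hx using hspec.2 x hx t) hspec'.1 hy
    refine (contDiffOn_succ_iff_fderiv_of_isOpen hU).2
      ⟨fun y hy => (hder y hy).differentiableAt.differentiableWithinAt, by simp, ?_⟩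
    refine ContDiffOn.congr ?_ fun y hy => (hder y hy).fderiv
    exact (ContinuousLinearMap.contDiff _).comp_contDiffOn
      (contDiffOn_rayMap_nat hU hs m hg'.2.2)

end Smooth

/-! ### The linear equation `φ'' = a φ' - b φ` on the unit interval -/

section LinearODE

/-- The extension to the real line of a function on the unit interval, constant on both sides. -/
def extend (x : C(unitInterval, ℝ)) : ℝ → ℝ := Set.IccExtend zero_le_one x

@[fun_prop]
theorem continuous_extend (x : C(unitInterval, ℝ)) : Continuous (extend x) :=
  x.continuous.Icc_extend'

theorem extend_of_mem (x : C(unitInterval, ℝ)) {t : ℝ} (ht : t ∈ Set.Icc (0 : ℝ) 1) :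
    extend x t = x ⟨t, ht⟩ := Set.IccExtend_of_mem _ _ ht

@[simp]
theorem extend_coe (x : C(unitInterval, ℝ)) (t : unitInterval) : extend x t = x t :=
  extend_of_mem x t.2

theorem intervalIntegrable_extend (x : C(unitInterval, ℝ)) (a b : ℝ) :
    IntervalIntegrable (extend x) MeasureTheory.volume a b :=
  (continuous_extend x).intervalIntegrable a b

theorem hasDerivAt_integral_extend (x : C(unitInterval, ℝ)) (t : ℝ) :
    HasDerivAt (fun u => ∫ s in (0 : ℝ)..u, extend x s) (extend x t) t :=
  ((continuous_extend x).integral_hasStrictDerivAt 0 t).hasDerivAt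

theorem abs_integral_extend_le {x : C(unitInterval, ℝ)} {c : ℝ} {m : ℕ}
    (hx : ∀ t : unitInterval, |x t| ≤ c * (t : ℝ) ^ m) (t : unitInterval) :
    |∫ s in (0 : ℝ)..t, extend x s| ≤ c * (t : ℝ) ^ (m + 1) / (m + 1) := by
  have h := intervalIntegral.norm_integral_le_of_norm_le (f := extend x)
    (g := fun s => c * s ^ m) (μ := MeasureTheory.volume) t.2.1
    (MeasureTheory.ae_of_all _ fun s hs => by
      have hs' : s ∈ Set.Icc (0 : ℝ) 1 := ⟨hs.1.le, hs.2.trans t.2.2⟩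
      rw [extend_of_mem x hs', Real.norm_eq_abs]
      exact hx ⟨s, hs'⟩)
    ((by fun_prop : Continuous fun s : ℝ => c * s ^ m).intervalIntegrable _ _)
  rw [Real.norm_eq_abs] at h
  refine h.trans (le_of_eq ?_)
  rw [intervalIntegral.integral_const_mul, integral_pow]
  simp
  ring

/-- The primitive vanishing at the origin, as an operator on `C([0, 1])`. -/
def primitive : C(unitInterval, ℝ) →L[ℝ] C(unitInterval, ℝ) :=
  LinearMap.mkContinuous
    { toFun := fun x => ⟨fun t => ∫ s in (0 : ℝ)..t, extend x s,
        (continuous_iff_continuousAt.2 fun t =>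
          (hasDerivAt_integral_extend x t).continuousAt).comp continuous_subtype_val⟩
      map_add' := fun x y => by
        ext t
        exact intervalIntegral.integral_add (intervalIntegrable_extend x _ _)
          (intervalIntegrable_extend y _ _)
      map_smul' := fun c x => by
        ext t
        exact intervalIntegral.integral_const_mul c _ }
    1 fun x => by
      refine (ContinuousMap.norm_le _ (by positivity)).2 fun t => ?_
      have := abs_integral_extend_le (x := x) (c := ‖x‖) (m := 0)
        (fun t => by simpa using x.norm_coe_le_norm t) t
      refine this.trans ?_
      have h1 := t.2.2
      have h2 := norm_nonneg x
      simp only [zero_add, pow_one, Nat.cast_zero, div_one, one_mul]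
      nlinarith

theorem primitive_apply (x : C(unitInterval, ℝ)) (t : unitInterval) :
    primitive x t = ∫ s in (0 : ℝ)..t, extend x s := rfl

theorem extend_primitive (x : C(unitInterval, ℝ)) {t : ℝ} (ht : t ∈ Set.Icc (0 : ℝ) 1) :
    extend (primitive x) t = ∫ s in (0 : ℝ)..t, extend x s := by
  rw [extend_of_mem _ ht, primitive_apply]

/-- The endpoints are excluded because the constant extension may have a corner there. -/
theorem hasDerivAt_extend_primitive (x : C(unitInterval, ℝ)) {t : ℝ} (ht : t ∈ Set.Ioo (0 : ℝ) 1) :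
    HasDerivAt (extend (primitive x)) (extend x t) t := by
  refine (hasDerivAt_integral_extend x t).congr_of_eventuallyEq ?_
  filter_upwards [isOpen_Ioo.mem_nhds ht] with s hs
    using extend_primitive x (Set.Ioo_subset_Icc_self hs)

/-- The Volterra operator `χ ↦ ∫ (a χ - b ∫ χ)`. -/
def volterra (a b : C(unitInterval, ℝ)) : C(unitInterval, ℝ) →L[ℝ] C(unitInterval, ℝ) :=
  primitive.comp (ContinuousLinearMap.mul ℝ _ a - (ContinuousLinearMap.mul ℝ _ b).comp primitive)

theorem volterra_apply (a b x : C(unitInterval, ℝ)) :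
    volterra a b x = primitive (a * x - b * primitive x) := rfl

theorem abs_volterra_pow_le (a b x : C(unitInterval, ℝ)) (m : ℕ) (t : unitInterval) :
    |(volterra a b ^ m) x t| ≤ (‖a‖ + ‖b‖) ^ m / m.factorial * ‖x‖ * (t : ℝ) ^ m := by
  induction m generalizing t with
  | zero => simpa using x.norm_coe_le_norm t
  | succ m ih =>
    set y := (volterra a b ^ m) x
    set c := (‖a‖ + ‖b‖) ^ m / m.factorial * ‖x‖
    have hc : 0 ≤ c := by positivity
    have h1 : ∀ s : unitInterval, |(a * y - b * primitive y) s| ≤ (‖a‖ + ‖b‖) * c * (s : ℝ) ^ m := by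
      intro s
      have h2 := abs_integral_extend_le ih s
      have h3 : c * (s : ℝ) ^ (m + 1) / (m + 1) ≤ c * (s : ℝ) ^ m := by
        rw [div_le_iff₀ (by positivity), mul_assoc c]
        refine mul_le_mul_of_nonneg_left ?_ hc
        rw [pow_succ]
        refine mul_le_mul_of_nonneg_left (s.2.2.trans ?_) (pow_nonneg s.2.1 _)
        have : (0 : ℝ) ≤ m := by positivity
        linarith
      have h4 := a.norm_coe_le_norm s
      have h5 := b.norm_coe_le_norm s
      rw [Real.norm_eq_abs] at h4 h5
      have h6 : |primitive y s| ≤ c * (s : ℝ) ^ m := h2.trans h3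
      calc |(a * y - b * primitive y) s| ≤ |a s| * |y s| + |b s| * |primitive y s| := by
            simp only [ContinuousMap.sub_apply, ContinuousMap.mul_apply, ← abs_mul]
            exact abs_sub _ _
        _ ≤ ‖a‖ * (c * (s : ℝ) ^ m) + ‖b‖ * (c * (s : ℝ) ^ m) := by
            have := ih s
            gcongr
        _ = _ := by ring
    have h2 := abs_integral_extend_le h1 t
    rw [pow_succ', mul_apply_eq_comp, volterra_apply, primitive_apply]
    refine h2.trans (le_of_eq ?_)
    simp only [c, Nat.factorial_succ, Nat.cast_mul, Nat.cast_succ]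
    field_simp
    ring

/-- No smallness of `a` and `b` is needed: by the factorial bound some power `T^m` of the Volterra
operator has norm less than `1`. Then `1 - T^m = (1 - T) ∑ T^i` is invertible, and so are its
commuting factors. -/
theorem isUnit_one_sub_volterra (a b : C(unitInterval, ℝ)) : IsUnit (1 - volterra a b) := by
  obtain ⟨m, hm⟩ := ((FloorSemiring.tendsto_pow_div_factorial_atTop (‖a‖ + ‖b‖)).eventually
    (gt_mem_nhds one_pos)).exists
  have h1 : ‖volterra a b ^ m‖ < 1 := by
    refine lt_of_le_of_lt (ContinuousLinearMap.opNorm_le_bound _ (by positivity) fun x => ?_) hm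
    refine (ContinuousMap.norm_le _ (by positivity)).2 fun t => ?_
    refine (abs_volterra_pow_le a b x m t).trans ?_
    exact mul_le_of_le_one_right (by positivity) (pow_le_one₀ t.2.1 t.2.2)
  have h2 : Commute (1 - volterra a b) (∑ i ∈ Finset.range m, volterra a b ^ i) :=
    (mul_neg_geom_sum _ _).trans (geom_sum_mul_neg _ _).symm
  refine (h2.isUnit_mul_iff.1 ?_).1
  rw [mul_neg_geom_sum]
  exact isUnit_one_sub_of_norm_lt_one (R := C(unitInterval, ℝ) →L[ℝ] C(unitInterval, ℝ)) h1

/-- The derivative of the solution of `φ'' = a φ' - b φ` with `φ(0) = 0`, `φ'(0) = 1`. -/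
def velocity (a b : C(unitInterval, ℝ)) : C(unitInterval, ℝ) :=
  -- The velocity solves `χ = 1 + ∫ (a χ - b ∫ χ)`, that is, `(1 - volterra a b) χ = 1`.
  Ring.inverse (1 - volterra a b) 1

/-- The solution of `φ'' = a φ' - b φ` with `φ(0) = 0`, `φ'(0) = 1`. -/
def position (a b : C(unitInterval, ℝ)) : C(unitInterval, ℝ) := primitive (velocity a b)

theorem velocity_eq (a b : C(unitInterval, ℝ)) :
    velocity a b = 1 + primitive (a * velocity a b - b * position a b) := by
  have h := congrArg (fun T => T (1 : C(unitInterval, ℝ)))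
    (Ring.mul_inverse_cancel _ (isUnit_one_sub_volterra a b))
  simp only [mul_apply_eq_comp, one_apply_eq_self] at h
  change (1 - volterra a b) (velocity a b) = 1 at h
  rw [_root_.sub_apply, one_apply_eq_self, volterra_apply] at h
  exact sub_eq_iff_eq_add.1 h

theorem velocity_zero_zero : velocity 0 0 = 1 := by
  rw [velocity_eq]; simp

/-- The Volterra operator is linear in `(a, b)`, and inversion is smooth at the units of a Banach
algebra. -/
theorem contDiff_velocity {m : WithTop ℕ∞} :
    ContDiff ℝ m fun p : C(unitInterval, ℝ) × C(unitInterval, ℝ) => velocity p.1 p.2 := by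
  have h1 : ContDiff ℝ m fun p : C(unitInterval, ℝ) × C(unitInterval, ℝ) =>
      (1 - volterra p.1 p.2 : C(unitInterval, ℝ) →L[ℝ] C(unitInterval, ℝ)) := by
    refine contDiff_const.sub (contDiff_const.clm_comp ?_)
    exact ((ContinuousLinearMap.contDiff _).comp contDiff_fst).sub
      (((ContinuousLinearMap.contDiff _).comp contDiff_snd).clm_comp contDiff_const)
  have h2 : ContDiff ℝ m fun p : C(unitInterval, ℝ) × C(unitInterval, ℝ) =>
      Ring.inverse (1 - volterra p.1 p.2) := by
    refine contDiff_iff_contDiffAt.2 fun p => ?_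
    obtain ⟨u, hu⟩ := isUnit_one_sub_volterra p.1 p.2
    have h3 := contDiffAt_ringInverse ℝ (n := m) (R := C(unitInterval, ℝ) →L[ℝ] C(unitInterval, ℝ)) u
    rw [hu] at h3
    exact h3.comp p h1.contDiffAt
  exact h2.clm_apply contDiff_const

theorem hasDerivAt_position (a b : C(unitInterval, ℝ)) {t : ℝ} (ht : t ∈ Set.Ioo (0 : ℝ) 1) :
    HasDerivAt (extend (position a b)) (extend (velocity a b) t) t :=
  hasDerivAt_extend_primitive _ ht

theorem hasDerivAt_velocity (a b : C(unitInterval, ℝ)) {t : ℝ} (ht : t ∈ Set.Ioo (0 : ℝ) 1) :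
    HasDerivAt (extend (velocity a b))
      (extend a t * extend (velocity a b) t - extend b t * extend (position a b) t) t := by
  have h := (hasDerivAt_extend_primitive (a * velocity a b - b * position a b) ht).const_add 1
  have h1 : extend (velocity a b)
      = fun s => 1 + extend (primitive (a * velocity a b - b * position a b)) s := by
    conv_lhs => rw [velocity_eq]
    rfl
  have h2 : extend (a * velocity a b - b * position a b) t
      = extend a t * extend (velocity a b) t - extend b t * extend (position a b) t := by
    simp [extend, Set.IccExtend]
  rwa [← h1, h2] at h

theorem extend_position (a b : C(unitInterval, ℝ)) {t : ℝ} (ht : t ∈ Set.Icc (0 : ℝ) 1) :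
    extend (position a b) t = ∫ s in (0 : ℝ)..t, extend (velocity a b) s :=
  extend_primitive _ ht

theorem extend_velocity_zero (a b : C(unitInterval, ℝ)) : extend (velocity a b) 0 = 1 := by
  rw [extend_of_mem _ ⟨le_rfl, zero_le_one⟩, velocity_eq, ContinuousMap.add_apply, primitive_apply]
  simp

theorem tendsto_position_div (a b : C(unitInterval, ℝ)) :
    Tendsto (fun t => extend (position a b) t / t) (𝓝[>] 0) (𝓝 1) := by
  have h := hasDerivAt_iff_tendsto_slope_zero.1 (hasDerivAt_integral_extend (velocity a b) 0)
  rw [extend_velocity_zero] at h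
  refine (h.mono_left (nhdsWithin_mono _ fun t (ht : 0 < t) => ht.ne')).congr' ?_
  filter_upwards [Ioo_mem_nhdsGT (zero_lt_one' ℝ)] with t ht
  rw [extend_position a b (Set.Ioo_subset_Icc_self ht)]
  simp [div_eq_inv_mul]

theorem eq_of_hasDerivAt_zero_Ioo {u : ℝ → ℝ} (hu : ∀ t ∈ Set.Ioo (0 : ℝ) 1, HasDerivAt u 0 t)
    {s t : ℝ} (hs : s ∈ Set.Ioo (0 : ℝ) 1) (ht : t ∈ Set.Ioo (0 : ℝ) 1) : u s = u t :=
  isOpen_Ioo.is_const_of_deriv_eq_zero isPreconnected_Ioo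
    (fun x hx => (hu x hx).differentiableAt.differentiableWithinAt) (fun x hx => (hu x hx).deriv)
    hs ht

theorem eq_of_tendsto_of_hasDerivAt_zero {u : ℝ → ℝ} {c : ℝ}
    (hu : ∀ t ∈ Set.Ioo (0 : ℝ) 1, HasDerivAt u 0 t) {ξ : ℝ → ℝ}
    (hξ : ∀ᶠ t in 𝓝[>] (0 : ℝ), ξ t ∈ Set.Ioo (0 : ℝ) 1)
    (hlim : Tendsto (fun t => u (ξ t)) (𝓝[>] 0) (𝓝 c)) {t : ℝ} (ht : t ∈ Set.Ioo (0 : ℝ) 1) :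
    u t = c := by
  refine tendsto_nhds_unique (tendsto_const_nhds.congr' ?_) hlim
  filter_upwards [hξ] with s hs using eq_of_hasDerivAt_zero_Ioo hu ht hs

/-- A positive solution of `u'' = a u' - b u` on `(0, 1)` with `u(t) / t → 1` at the origin is the
solution with `u(0) = 0`, `u'(0) = 1`. No regularity of `u'` at the origin is required. -/
theorem extend_position_eq_of_ode {a b : C(unitInterval, ℝ)} {u v : ℝ → ℝ}
    (hu : ∀ t ∈ Set.Ioo (0 : ℝ) 1, HasDerivAt u (v t) t)
    (hv : ∀ t ∈ Set.Ioo (0 : ℝ) 1, HasDerivAt v (extend a t * v t - extend b t * u t) t)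
    (hpos : ∀ t ∈ Set.Ioo (0 : ℝ) 1, 0 < u t)
    (hlim : Tendsto (fun t => u t / t) (𝓝[>] 0) (𝓝 1)) {t : ℝ} (ht : t ∈ Set.Ioo (0 : ℝ) 1) :
    extend (position a b) t = u t := by
  set φ := extend (position a b)
  set χ := extend (velocity a b)
  set A : ℝ → ℝ := fun t => ∫ s in (0 : ℝ)..t, extend a s
  have hid : Tendsto (fun t : ℝ => t) (𝓝[>] 0) (𝓝 0) := tendsto_nhdsWithin_of_tendsto_nhds tendsto_id
  have hpos0 : ∀ᶠ t : ℝ in 𝓝[>] 0, t ∈ Set.Ioo (0 : ℝ) 1 := Ioo_mem_nhdsGT one_pos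
  have hu0 : Tendsto u (𝓝[>] 0) (𝓝 0) := by
    have := hlim.mul hid
    rw [mul_zero] at this
    refine this.congr' ?_
    filter_upwards [hpos0] with t ht using div_mul_cancel₀ _ ht.1.ne'
  -- the Wronskian vanishes
  have hW : ∀ t ∈ Set.Ioo (0 : ℝ) 1, φ t * v t - u t * χ t = 0 := by
    -- Abel's identity: the Wronskian satisfies `W' = a W`.
    have hZ : ∀ t ∈ Set.Ioo (0 : ℝ) 1,
        HasDerivAt (fun t => (φ t * v t - u t * χ t) * Real.exp (-A t)) 0 t := by
      intro t ht
      have h1 := (((hasDerivAt_position a b ht).mul (hv t ht)).sub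
        ((hu t ht).mul (hasDerivAt_velocity a b ht))).mul
        ((hasDerivAt_integral_extend a t).neg.exp)
      convert! h1 using 1
      simp only [Pi.mul_apply, Pi.sub_apply]
      ring
    -- Nothing is known of `v` near `0`, but the mean value theorem on `[t, 2 t]` gives a point `ξ`
    -- where `v` is `2 (u(2t) / (2t)) - u(t) / t`, which tends to `2 - 1 = 1`. As `W exp (-A)` is
    -- constant, its limit along these points suffices.
    have hslope : ∀ t : ℝ, ∃ ξ, 0 < t → t < 1 / 2 →
        ξ ∈ Set.Ioo t (2 * t) ∧ v ξ = 2 * (u (2 * t) / (2 * t)) - u t / t := by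
      intro t
      by_cases h : 0 < t ∧ t < 1 / 2
      · have hsub : Set.Icc t (2 * t) ⊆ Set.Ioo 0 1 := fun s hs =>
          ⟨h.1.trans_le hs.1, by linarith [hs.2, h.2]⟩
        obtain ⟨ξ, hξ, hξ'⟩ := exists_hasDerivAt_eq_slope u v (by linarith [h.1] : t < 2 * t)
          (fun s hs => (hu s (hsub hs)).continuousAt.continuousWithinAt)
          (fun s hs => hu s (hsub (Set.Ioo_subset_Icc_self hs)))
        refine ⟨ξ, fun _ _ => ⟨hξ, ?_⟩⟩
        rw [hξ']
        have := h.1.ne'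
        field_simp
        ring
      · exact ⟨0, fun h1 h2 => absurd ⟨h1, h2⟩ h⟩
    choose ξ hξ using hslope
    have hhalf : ∀ᶠ t : ℝ in 𝓝[>] 0, t ∈ Set.Ioo (0 : ℝ) (1 / 2) :=
      Ioo_mem_nhdsGT (by norm_num)
    have h2t : Tendsto (fun t : ℝ => 2 * t) (𝓝[>] 0) (𝓝[>] 0) := by
      refine tendsto_nhdsWithin_iff.2 ⟨by simpa using hid.const_mul 2, ?_⟩
      filter_upwards [hpos0] with t ht using mul_pos two_pos ht.1
    have hξlim : Tendsto ξ (𝓝[>] 0) (𝓝[>] 0) := by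
      refine tendsto_nhdsWithin_iff.2 ⟨?_, ?_⟩
      · refine tendsto_of_tendsto_of_tendsto_of_le_of_le' hid
          (tendsto_nhds_of_tendsto_nhdsWithin h2t) ?_ ?_
        · filter_upwards [hhalf] with t ht using (hξ t ht.1 ht.2).1.1.le
        · filter_upwards [hhalf] with t ht using (hξ t ht.1 ht.2).1.2.le
      · filter_upwards [hhalf] with t ht using ht.1.trans (hξ t ht.1 ht.2).1.1
    have hvlim : Tendsto (fun t => v (ξ t)) (𝓝[>] 0) (𝓝 1) := by
      have h1 := ((hlim.comp h2t).const_mul 2).sub hlim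
      norm_num at h1
      refine h1.congr' ?_
      filter_upwards [hhalf] with t ht using ((hξ t ht.1 ht.2).2).symm
    have hξ0 : Tendsto ξ (𝓝[>] 0) (𝓝 0) := tendsto_nhds_of_tendsto_nhdsWithin hξlim
    have hφ : Tendsto (fun t => φ (ξ t)) (𝓝[>] 0) (𝓝 0) := by
      have h1 := ((continuous_extend (position a b)).tendsto 0).comp hξ0
      rwa [extend_position a b ⟨le_rfl, zero_le_one⟩, intervalIntegral.integral_same] at h1
    have hχ : Tendsto (fun t => χ (ξ t)) (𝓝[>] 0) (𝓝 1) := by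
      have h1 := ((continuous_extend (velocity a b)).tendsto 0).comp hξ0
      rwa [extend_velocity_zero] at h1
    have hA : Tendsto (fun t => Real.exp (-A (ξ t))) (𝓝[>] 0) (𝓝 1) := by
      have h1 := ((hasDerivAt_integral_extend a 0).neg.exp.continuousAt.tendsto).comp hξ0
      simpa [Function.comp_def] using h1
    intro t ht
    have h1 := ((hφ.mul hvlim).sub ((hu0.comp hξlim).mul hχ)).mul hA
    have h2 := eq_of_tendsto_of_hasDerivAt_zero hZ (hξlim.eventually hpos0) h1 ht
    simpa [Real.exp_ne_zero] using h2
  -- The numerator of the derivative of `φ / u` is minus the Wronskian; the quotient is thus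
  -- constant, with limit `1` at the origin.
  have hq : ∀ t ∈ Set.Ioo (0 : ℝ) 1, HasDerivAt (fun t => φ t / u t) 0 t := by
    intro t ht
    convert! (hasDerivAt_position a b ht).div (hu t ht) (hpos t ht).ne' using 1
    have h1 := hW t ht
    have h2 : χ t * u t - φ t * v t = 0 := by linarith
    change 0 = (χ t * u t - φ t * v t) / u t ^ 2
    rw [h2, zero_div]
  have hqlim : Tendsto (fun t => φ t / u t) (𝓝[>] 0) (𝓝 1) := by
    have h1 := (tendsto_position_div a b).div hlim one_ne_zero
    rw [div_one] at h1
    refine h1.congr' ?_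
    filter_upwards [hpos0] with t ht
    exact div_div_div_cancel_right₀ ht.1.ne' _ _
  have h1 := eq_of_tendsto_of_hasDerivAt_zero hq hpos0 hqlim ht
  exact (div_eq_one_iff_eq (hpos t ht).ne').1 h1

end LinearODE

open Matrix

/-! ### Frames of the sphere and the screen space -/

section Frame

variable {n : ℕ} {Θ : Fin n → ℝ} {e : Fin (n - 1) → Fin n → ℝ}

theorem exists_isFrame (hΘ : ∑ i, Θ i ^ 2 = 1) : ∃ e, IsFrame Θ e := by
  have hdot : Θ ⬝ᵥ Θ = 1 := by simpa [dotProduct, sq] using hΘ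
  obtain ⟨f, hfv⟩ : ∃ f : Module.Dual ℝ (Fin n → ℝ), ∀ v, f v = Θ ⬝ᵥ v :=
    ⟨dotProductBilin ℝ ℝ Θ, fun _ => rfl⟩
  have hf : f ≠ 0 := fun h => by
    have : f Θ = 0 := by rw [h]; rfl
    rw [hfv, hdot] at this
    exact one_ne_zero this
  have hrank : Module.finrank ℝ (LinearMap.ker f) = n - 1 := by
    have := Module.Dual.finrank_ker_add_one_of_ne_zero hf
    rw [Module.finrank_fin_fun] at this
    omega
  let b := Module.finBasisOfFinrankEq ℝ (LinearMap.ker f) hrank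
  refine ⟨fun A => b A, hΘ, fun A => ?_, ?_⟩
  · have h1 : f (b A) = 0 := (b A).2
    rw [hfv, dotProduct_comm] at h1
    exact h1
  · exact b.linearIndependent.map' (LinearMap.ker f).subtype (LinearMap.ker f).ker_subtype

theorem IsFrame.exists_eq_smul (h : IsFrame Θ e) {p : Fin n → ℝ} (hp : ∀ A, e A ⬝ᵥ p = 0) :
    ∃ c : ℝ, p = c • Θ := by
  have hn : n ≠ 0 := by
    rintro rfl
    simpa using h.unit
  have hΘ0 : Θ ≠ 0 := by
    rintro rfl
    simpa using h.unit
  let M : Matrix (Fin (n - 1)) (Fin n) ℝ := of e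
  have hrank : M.rank = n - 1 := by
    have := LinearIndependent.rank_matrix (M := M) h.linearIndependent
    simpa using this
  have hker : Module.finrank ℝ (LinearMap.ker M.mulVecLin) = 1 := by
    have := M.mulVecLin.finrank_range_add_finrank_ker
    rw [Module.finrank_fin_fun] at this
    change M.rank + _ = n at this
    omega
  have hmem : ∀ q : Fin n → ℝ, (∀ A, e A ⬝ᵥ q = 0) → q ∈ LinearMap.ker M.mulVecLin :=
    fun q hq => by
      rw [LinearMap.mem_ker]
      ext A
      exact hq A
  have hΘ : ∀ A, e A ⬝ᵥ Θ = 0 := h.tangent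
  obtain ⟨c, hc⟩ := (finrank_eq_one_iff_of_nonzero' (⟨Θ, hmem Θ hΘ⟩ : LinearMap.ker M.mulVecLin)
    (fun h0 => hΘ0 (congrArg Subtype.val h0))).1 hker ⟨p, hmem p hp⟩
  exact ⟨c, (congrArg Subtype.val hc).symm⟩

/-- The matrix whose rows are the vectors `(0, e_A)`. -/
def frameMatrix (e : Fin (n - 1) → Fin n → ℝ) : Matrix (Fin (n - 1)) (Fin (n + 1)) ℝ :=
  of fun A => Fin.cons 0 (e A)

@[simp]
theorem frameMatrix_zero (A : Fin (n - 1)) : frameMatrix e A 0 = 0 := rfl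

@[simp]
theorem frameMatrix_succ (A : Fin (n - 1)) (i : Fin n) : frameMatrix e A i.succ = e A i := rfl

@[simp]
theorem conePoint_zero (r : ℝ) : conePoint r Θ 0 = r := rfl

@[simp]
theorem conePoint_succ (r : ℝ) (i : Fin n) : conePoint r Θ i.succ = r * Θ i := rfl

theorem conePoint_eq_smul (r s : ℝ) : conePoint (s * r) Θ = s • conePoint r Θ := by
  ext i
  refine Fin.cases ?_ (fun i => ?_) i <;> simp [mul_assoc]

theorem conePoint_eq_smul_one (r : ℝ) : conePoint r Θ = r • conePoint 1 Θ := by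
  rw [← conePoint_eq_smul, mul_one]

theorem minkowski_mulVec_zero (v : Spacetime n) : (minkowski n *ᵥ v) 0 = -v 0 := by
  simp [minkowski, mulVec_diagonal]

theorem minkowski_mulVec_succ (v : Spacetime n) (i : Fin n) :
    (minkowski n *ᵥ v) i.succ = v i.succ := by
  simp [minkowski, mulVec_diagonal]

theorem IsFrame.frameMatrix_mulVec (h : IsFrame Θ e) :
    frameMatrix e *ᵥ (minkowski n *ᵥ conePoint 1 Θ) = 0 := by
  ext A
  rw [mulVec, dotProduct, Fin.sum_univ_succ]
  simpa [minkowski_mulVec_succ] using h.tangent A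

/-- Orthogonality to the frame makes the spatial part a multiple of `Θ`; the null vector then fixes
the time component. -/
theorem IsFrame.exists_eq_smul_minkowski (h : IsFrame Θ e) {w : Spacetime n}
    (hw : frameMatrix e *ᵥ w = 0) (hw' : conePoint 1 Θ ⬝ᵥ w = 0) :
    ∃ c : ℝ, w = c • (minkowski n *ᵥ conePoint 1 Θ) := by
  obtain ⟨c, hc⟩ := h.exists_eq_smul (p := fun i => w i.succ) fun A => by
    have := congrFun hw A
    rw [mulVec, dotProduct, Fin.sum_univ_succ] at this
    simpa [dotProduct] using this
  have hs : ∀ i : Fin n, w i.succ = c * Θ i := fun i => congrFun hc i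
  refine ⟨c, ?_⟩
  ext i
  refine Fin.cases ?_ (fun i => ?_) i
  · rw [dotProduct, Fin.sum_univ_succ] at hw'
    have h1 : ∑ i, Θ i * (c * Θ i) = c := by
      have h2 := congrArg (c * ·) h.unit
      rw [Finset.mul_sum, mul_one] at h2
      exact (Finset.sum_congr rfl fun i _ => by ring).trans h2
    simp only [conePoint_zero, conePoint_succ, one_mul, hs, h1] at hw'
    rw [Pi.smul_apply, minkowski_mulVec_zero, conePoint_zero, smul_eq_mul]
    linarith
  · rw [Pi.smul_apply, minkowski_mulVec_succ, hs]
    simp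

end Frame

/-! ### Linear algebra of a null vector and its screen space -/

section NullAlgebra

variable {n : ℕ} {Θ : Fin n → ℝ} {e : Fin (n - 1) → Fin n → ℝ}
  {C N : Matrix (Fin (n + 1)) (Fin (n + 1)) ℝ}

theorem IsFrame.exists_eq_smul_conePoint (h : IsFrame Θ e) (hdet : IsUnit C.det)
    (hCl : C *ᵥ conePoint 1 Θ = minkowski n *ᵥ conePoint 1 Θ) {v : Spacetime n}
    (hv : frameMatrix e *ᵥ (C *ᵥ v) = 0) (hv' : conePoint 1 Θ ⬝ᵥ (C *ᵥ v) = 0) :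
    ∃ c : ℝ, v = c • conePoint 1 Θ := by
  obtain ⟨c, hc⟩ := h.exists_eq_smul_minkowski hv hv'
  refine ⟨c, ?_⟩
  have := congrArg (C⁻¹ *ᵥ ·) hc
  simpa only [← hCl, ← mulVec_smul, mulVec_mulVec, nonsing_inv_mul _ hdet, one_mulVec] using this

theorem dotProduct_mulVec_of_isSymm (hC : C.IsSymm) (v w : Spacetime n) :
    v ⬝ᵥ (C *ᵥ w) = (C *ᵥ v) ⬝ᵥ w := by
  rw [dotProduct_mulVec, ← mulVec_transpose, hC.eq]

theorem IsFrame.dotProduct_mulVec_frameMatrix (h : IsFrame Θ e) (hC : C.IsSymm)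
    (hCl : C *ᵥ conePoint 1 Θ = minkowski n *ᵥ conePoint 1 Θ) (c : Fin (n - 1) → ℝ) :
    conePoint 1 Θ ⬝ᵥ (C *ᵥ ((frameMatrix e)ᵀ *ᵥ c)) = 0 := by
  rw [dotProduct_mulVec_of_isSymm hC, hCl, dotProduct_mulVec, vecMul_transpose,
    h.frameMatrix_mulVec, zero_dotProduct]

/-- A nondegenerate quadratic form is nondegenerate on the screen space of a null vector. -/
theorem IsFrame.isUnit_det (h : IsFrame Θ e) (hC : C.IsSymm) (hdet : IsUnit C.det)
    (hCl : C *ᵥ conePoint 1 Θ = minkowski n *ᵥ conePoint 1 Θ) :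
    IsUnit (frameMatrix e * C * (frameMatrix e)ᵀ).det := by
  rw [isUnit_iff_ne_zero]
  intro h0
  obtain ⟨c, hc0, hc⟩ := exists_mulVec_eq_zero_iff.2 h0
  -- A kernel vector `c` yields a combination of the frame orthogonal to the screen space and to the
  -- null vector, hence a multiple of the latter. Its time component is `0`, so it vanishes.
  obtain ⟨a, ha⟩ := h.exists_eq_smul_conePoint hdet hCl (v := (frameMatrix e)ᵀ *ᵥ c)
    (by simpa only [mulVec_mulVec, Matrix.mul_assoc] using hc)
    (h.dotProduct_mulVec_frameMatrix hC hCl c)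
  have ha0 : a = 0 := by
    have := congrFun ha 0
    simpa [mulVec, dotProduct] using this.symm
  refine hc0 (funext fun A => Fintype.linearIndependent_iff.1 h.linearIndependent c ?_ A)
  ext i
  have := congrFun ha i.succ
  rw [ha0, zero_smul] at this
  simpa [mulVec, dotProduct, mul_comm] using this

/-- The traces over spacetime and over the screen space agree for an endomorphism `C⁻¹ N` such that
`N` annihilates the null vector. -/
theorem IsFrame.trace_eq (h : IsFrame Θ e) (hC : C.IsSymm) (hdet : IsUnit C.det)
    (hCl : C *ᵥ conePoint 1 Θ = minkowski n *ᵥ conePoint 1 Θ)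
    (hN : N.IsSymm) (hNl : N *ᵥ conePoint 1 Θ = 0) :
    (C⁻¹ * N).trace = ((frameMatrix e * N * (frameMatrix e)ᵀ) *
        (frameMatrix e * C * (frameMatrix e)ᵀ)⁻¹).trace ∧
      (C⁻¹ * N * (C⁻¹ * N)).trace =
        ((frameMatrix e * N * (frameMatrix e)ᵀ) * (frameMatrix e * C * (frameMatrix e)ᵀ)⁻¹ *
        ((frameMatrix e * N * (frameMatrix e)ᵀ) *
          (frameMatrix e * C * (frameMatrix e)ᵀ)⁻¹)).trace := by
  have hunit := h.isUnit_det hC hdet hCl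
  set l := conePoint 1 Θ
  set E := frameMatrix e
  set g := E * C * Eᵀ with hg
  set K := Eᵀ * g⁻¹ * E * N with hK
  -- `K` is `C⁻¹ N` followed by the `C`-orthogonal projection onto the screen space. The difference
  -- is orthogonal to the screen space and, as `N l = 0`, to `l`, so its values lie on the line of
  -- `l`.
  have hcol : ∀ u : Spacetime n, ∃ c : ℝ, (C⁻¹ * N - K) *ᵥ u = c • l := by
    intro u
    have hCv : C *ᵥ ((C⁻¹ * N - K) *ᵥ u) = N *ᵥ u - C *ᵥ (Eᵀ *ᵥ (g⁻¹ *ᵥ (E *ᵥ (N *ᵥ u)))) := by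
      rw [sub_mulVec, mulVec_sub]
      simp only [hK, mulVec_mulVec, Matrix.mul_assoc]
      rw [← Matrix.mul_assoc C C⁻¹, mul_nonsing_inv _ hdet, Matrix.one_mul]
    refine h.exists_eq_smul_conePoint hdet hCl ?_ ?_
    · rw [hCv, mulVec_sub]
      have : E *ᵥ (C *ᵥ (Eᵀ *ᵥ (g⁻¹ *ᵥ (E *ᵥ (N *ᵥ u))))) = (g * g⁻¹) *ᵥ (E *ᵥ (N *ᵥ u)) := by
        simp only [hg, mulVec_mulVec, Matrix.mul_assoc]
      rw [this, mul_nonsing_inv _ hunit, one_mulVec, sub_self]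
    · rw [hCv, dotProduct_sub, h.dotProduct_mulVec_frameMatrix hC hCl,
        dotProduct_mulVec_of_isSymm hN, hNl, zero_dotProduct, sub_zero]
  choose c hc using hcol
  set w : Spacetime n := fun j => c (Pi.single j 1)
  -- The difference is the rank-one matrix `l wᵀ`. Both `C⁻¹ N` and `K` kill `l`, so `w` annihilates
  -- `l` and this term contributes to neither trace.
  have hdec : C⁻¹ * N = K + vecMulVec l w := by
    rw [← sub_eq_iff_eq_add']
    ext i j
    have := congrFun (hc (Pi.single j 1)) i
    rw [mulVec_single_one] at this
    simpa [vecMulVec_apply, w, mul_comm] using this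
  have hKl : K *ᵥ l = 0 := by
    rw [hK, ← mulVec_mulVec, hNl, mulVec_zero]
  have hTl : (C⁻¹ * N) *ᵥ l = 0 := by
    rw [← mulVec_mulVec, hNl, mulVec_zero]
  have hwl : l ⬝ᵥ w = 0 := by
    have h1 := hTl
    rw [hdec, add_mulVec, hKl, zero_add, vecMulVec_mulVec] at h1
    have := congrFun h1 0
    rw [dotProduct_comm]
    simpa [l] using this
  have hKtr : K.trace = (E * N * Eᵀ * g⁻¹).trace := by
    rw [hK, Matrix.mul_assoc, Matrix.mul_assoc, trace_mul_comm, trace_mul_comm _ g⁻¹]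
    simp only [Matrix.mul_assoc]
  have hKK : (K * K).trace = (E * N * Eᵀ * g⁻¹ * (E * N * Eᵀ * g⁻¹)).trace := by
    have : K * K = Eᵀ * (g⁻¹ * (E * N * Eᵀ) * g⁻¹ * E * N) := by
      simp only [hK, Matrix.mul_assoc]
    rw [this, trace_mul_comm]
    have : g⁻¹ * (E * N * Eᵀ) * g⁻¹ * E * N * Eᵀ = g⁻¹ * ((E * N * Eᵀ) * g⁻¹ * (E * N * Eᵀ)) := by
      simp only [Matrix.mul_assoc]
    rw [this, trace_mul_comm]
    simp only [Matrix.mul_assoc]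
  constructor
  · rw [← hKtr, hdec, trace_add, trace_vecMulVec, hwl, add_zero]
  · rw [← hKK]
    have h1 : C⁻¹ * N * (C⁻¹ * N) = C⁻¹ * N * K := by
      conv_lhs => rw [hdec, Matrix.mul_add, mul_vecMulVec, ← hdec, hTl, zero_vecMulVec, add_zero]
    rw [h1, hdec, Matrix.add_mul, trace_add, vecMulVec_mul, trace_vecMulVec,
      dotProduct_comm, ← dotProduct_mulVec, hKl, dotProduct_zero, add_zero]

end NullAlgebra

/-! ### Lorentzian matrices are symmetric and invertible -/

section Lorentzian

variable {n : ℕ}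

theorem IsLorentzian.isUnit_det {M : Matrix (Fin (n + 1)) (Fin (n + 1)) ℝ} (h : IsLorentzian M) :
    IsUnit M.det := by
  obtain ⟨P, hP, h⟩ := h
  have h1 : (minkowski n).det ≠ 0 := by
    simp [minkowski, Fin.prod_univ_succ]
  rw [← h, det_mul, det_mul] at h1
  rw [isUnit_iff_ne_zero]
  intro h0
  simp [h0] at h1

theorem IsLorentzian.isSymm {M : Matrix (Fin (n + 1)) (Fin (n + 1)) ℝ} (h : IsLorentzian M) :
    M.IsSymm := by
  obtain ⟨P, hP, h⟩ := h
  have hPt : IsUnit Pᵀ.det := by rwa [det_transpose]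
  have hM : M = (Pᵀ)⁻¹ * minkowski n * P⁻¹ := by
    rw [← h]
    simp only [Matrix.mul_assoc]
    rw [mul_nonsing_inv _ hP, Matrix.mul_one, ← Matrix.mul_assoc, nonsing_inv_mul _ hPt,
      Matrix.one_mul]
  rw [Matrix.IsSymm, hM]
  simp [transpose_mul, transpose_nonsing_inv, minkowski, Matrix.mul_assoc]

end Lorentzian

/-! ### The Gauss lemma -/

section Gauss

variable {n : ℕ} {C : TensorField n} {U : Set (Spacetime n)}

/-- The matrix of the derivatives of the components of `C` at `y` in the direction `v`. -/
def directionalDeriv (C : TensorField n) (y v : Spacetime n) :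
    Matrix (Fin (n + 1)) (Fin (n + 1)) ℝ :=
  of fun μ ν => fderiv ℝ (fun z => C z μ ν) y v

theorem fderiv_eq_sum_partialDeriv (f : Spacetime n → ℝ) (y v : Spacetime n) :
    fderiv ℝ f y v = ∑ a, partialDeriv a f y * v a := by
  conv_lhs => rw [← Finset.univ_sum_single v]
  rw [map_sum]
  refine Finset.sum_congr rfl fun a _ => ?_
  have h : (Pi.single a (v a) : Spacetime n) = v a • Pi.single a 1 := by
    rw [← Pi.single_smul, smul_eq_mul, mul_one]
  rw [h, map_smul, smul_eq_mul, mul_comm, partialDeriv]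

theorem isSymm_directionalDeriv (hU : IsOpen U) (hsymm : ∀ y ∈ U, (C y).IsSymm) {y : Spacetime n}
    (hy : y ∈ U) (v : Spacetime n) : (directionalDeriv C y v).IsSymm := by
  ext μ ν
  simp only [directionalDeriv, transpose_apply, of_apply]
  have h : (fun z => C z ν μ) =ᶠ[𝓝 y] fun z => C z μ ν := by
    filter_upwards [hU.mem_nhds hy] with z hz using (hsymm z hz).apply μ ν
  rw [h.fderiv_eq]

/-- The geodesic equation for the straight lines through the origin, with the index lowered. -/
theorem IsNormalOn.two_mul_directionalDeriv (h : IsNormalOn C U)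
    (hdet : ∀ y ∈ U, IsUnit (C y).det) {v : Spacetime n} {t : ℝ} (ht : t • v ∈ U)
    (ν : Fin (n + 1)) :
    2 * (directionalDeriv C (t • v) v *ᵥ v) ν
      = ∑ a, ∑ b, partialDeriv ν (fun z => C z a b) (t • v) * v a * v b := by
  set x := t • v
  set w : Spacetime n := fun ν => ∑ a, ∑ b, (partialDeriv a (fun z => C z ν b) x
    + partialDeriv b (fun z => C z ν a) x - partialDeriv ν (fun z => C z a b) x) * v a * v b
  have hw : (C x)⁻¹ *ᵥ w = 0 := by
    ext l
    have h1 := h.geodesic v t ht l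
    have h2 : ∑ a, ∑ b, christoffel C x l a b * v a * v b = 1 / 2 * ((C x)⁻¹ *ᵥ w) l := by
      simp only [christoffel, mulVec, dotProduct, w, Finset.mul_sum, Finset.sum_mul]
      rw [Finset.sum_comm' (t' := Finset.univ) (s' := fun _ => Finset.univ) (by simp)]
      conv_rhs => rw [Finset.sum_comm]
      conv_rhs => enter [2, a]; rw [Finset.sum_comm]
      rw [Finset.sum_comm]
      refine Finset.sum_congr rfl fun a _ => Finset.sum_congr rfl fun b _ =>
        Finset.sum_congr rfl fun ν _ => by ring
    rw [h2] at h1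
    simpa using h1
  have hw0 : w = 0 := by
    have := congrArg (C x *ᵥ ·) hw
    simpa [mulVec_mulVec, mul_nonsing_inv _ (hdet x ht)] using this
  have h3 := congrFun hw0 ν
  have h4 : (directionalDeriv C x v *ᵥ v) ν
      = ∑ a, ∑ b, partialDeriv a (fun z => C z ν b) x * v a * v b := by
    rw [mulVec, dotProduct, Finset.sum_comm]
    refine Finset.sum_congr rfl fun b _ => ?_
    rw [directionalDeriv, of_apply, fderiv_eq_sum_partialDeriv, Finset.sum_mul]
  have h5 : (directionalDeriv C x v *ᵥ v) ν
      = ∑ a, ∑ b, partialDeriv b (fun z => C z ν a) x * v a * v b := by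
    rw [h4, Finset.sum_comm]
    exact Finset.sum_congr rfl fun b _ => Finset.sum_congr rfl fun a _ => by ring
  simp only [w, sub_mul, add_mul, Finset.sum_sub_distrib, Finset.sum_add_distrib, ← h4, ← h5,
    Pi.zero_apply] at h3
  linarith

theorem hasDerivAt_ray {f : Spacetime n → ℝ} {y : Spacetime n} {t : ℝ}
    (hf : DifferentiableAt ℝ f (t • y)) :
    HasDerivAt (fun s : ℝ => f (s • y)) (fderiv ℝ f (t • y) y) t := by
  have h1 : HasDerivAt (fun s : ℝ => s • y) y t := by
    simpa using (hasDerivAt_id t).smul_const y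
  exact hf.hasFDerivAt.comp_hasDerivAt t h1

theorem eq_of_hasDerivAt_zero {h : ℝ → ℝ} (hh : ∀ t ∈ Set.Icc (0 : ℝ) 1, HasDerivAt h 0 t) :
    h 1 = h 0 :=
  constant_of_has_deriv_right_zero (fun t ht => (hh t ht).continuousAt.continuousWithinAt)
    (fun t ht => (hh t (Set.Ico_subset_Icc_self ht)).hasDerivWithinAt) 1 ⟨zero_le_one, le_rfl⟩

theorem hasDerivAt_ray_mulVec {w y : Spacetime n} {t : ℝ}
    (hdiff : ∀ μ ν, DifferentiableAt ℝ (fun z => C z μ ν) (t • y)) (μ : Fin (n + 1)) :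
    HasDerivAt (fun s : ℝ => (C (s • y) *ᵥ w) μ) ((directionalDeriv C (t • y) y *ᵥ w) μ) t := by
  simp only [mulVec, dotProduct]
  exact HasDerivAt.fun_sum fun ν _ => (hasDerivAt_ray (hdiff μ ν)).mul_const _

/-- An affinely parametrized geodesic has velocity of constant length: contracted with `y`, the
lowered geodesic equation says that `q = yᵀ (∂_y C) y` satisfies `2 q = q`. -/
theorem dotProduct_mulVec_self_eq (hs : StarConvex ℝ 0 U)
    (hdiff : ∀ y ∈ U, ∀ μ ν, DifferentiableAt ℝ (fun z => C z μ ν) y)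
    (hdet : ∀ y ∈ U, IsUnit (C y).det) (h : IsNormalOn C U) {y : Spacetime n} (hy : y ∈ U) :
    y ⬝ᵥ (C y *ᵥ y) = y ⬝ᵥ (minkowski n *ᵥ y) := by
  have hmem : ∀ t ∈ Set.Icc (0 : ℝ) 1, t • y ∈ U := fun t ht => hs.smul_mem hy ht.1 ht.2
  have hder : ∀ t ∈ Set.Icc (0 : ℝ) 1, HasDerivAt (fun s : ℝ => y ⬝ᵥ (C (s • y) *ᵥ y)) 0 t := by
    intro t ht
    have h1 : HasDerivAt (fun s : ℝ => y ⬝ᵥ (C (s • y) *ᵥ y))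
        (y ⬝ᵥ (directionalDeriv C (t • y) y *ᵥ y)) t := by
      simp only [dotProduct]
      exact HasDerivAt.fun_sum fun μ _ =>
        (hasDerivAt_ray_mulVec (hdiff _ (hmem t ht)) μ).const_mul _
    have h2 : 2 * (y ⬝ᵥ (directionalDeriv C (t • y) y *ᵥ y))
        = y ⬝ᵥ (directionalDeriv C (t • y) y *ᵥ y) := by
      conv_lhs => rw [dotProduct, Finset.mul_sum]
      have h3 : ∀ ν, 2 * (y ν * (directionalDeriv C (t • y) y *ᵥ y) ν) = ∑ a, ∑ b,
          partialDeriv ν (fun z => C z a b) (t • y) * y a * y b * y ν := by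
        intro ν
        rw [mul_left_comm, h.two_mul_directionalDeriv hdet (hmem t ht), mul_comm, Finset.sum_mul]
        simp only [Finset.sum_mul]
      simp only [h3]
      rw [Finset.sum_comm, dotProduct]
      refine Finset.sum_congr rfl fun a _ => ?_
      rw [Finset.sum_comm, mulVec, dotProduct, Finset.mul_sum]
      refine Finset.sum_congr rfl fun b _ => ?_
      rw [directionalDeriv, of_apply, fderiv_eq_sum_partialDeriv, Finset.sum_mul, Finset.mul_sum]
      exact Finset.sum_congr rfl fun c _ => by ring
    have h4 : y ⬝ᵥ (directionalDeriv C (t • y) y *ᵥ y) = 0 := by linarith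
    rwa [h4] at h1
  have := eq_of_hasDerivAt_zero hder
  simpa [h.at_origin] using this

theorem fderiv_quadratic {A : TensorField n} {x : Spacetime n} (hsymm : (A x).IsSymm)
    (hdiff : ∀ μ ν, DifferentiableAt ℝ (fun z => A z μ ν) x) (ν : Fin (n + 1)) :
    fderiv ℝ (fun z => z ⬝ᵥ (A z *ᵥ z)) x (Pi.single ν 1)
      = (∑ a, ∑ b, partialDeriv ν (fun z => A z a b) x * x a * x b) + 2 * (A x *ᵥ x) ν := by
  have hcoord : ∀ a : Fin (n + 1), HasFDerivAt (fun z : Spacetime n => z a)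
      (ContinuousLinearMap.proj a : Spacetime n →L[ℝ] ℝ) x := fun a =>
    (ContinuousLinearMap.proj a : Spacetime n →L[ℝ] ℝ).hasFDerivAt
  have h1 := HasFDerivAt.fun_sum (u := Finset.univ) fun (a : Fin (n + 1)) _ => (hcoord a).fun_mul
    (HasFDerivAt.fun_sum (u := Finset.univ) fun (b : Fin (n + 1)) _ =>
      (hdiff a b).hasFDerivAt.fun_mul (hcoord b))
  have h0 : (fun z : Spacetime n => z ⬝ᵥ (A z *ᵥ z))
      = fun z => ∑ a, z a * ∑ b, A z a b * z b := rfl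
  rw [h0, h1.fderiv]
  have h2 : ∀ a, ∑ b, A x a b * x b = (A x *ᵥ x) a := fun a => rfl
  have h3 : ∑ a, x a * A x a ν = (A x *ᵥ x) ν := by
    rw [mulVec, dotProduct]
    exact Finset.sum_congr rfl fun a _ => by rw [hsymm.apply, mul_comm]
  simp only [_root_.sum_apply, _root_.add_apply,
    _root_.smul_apply, ContinuousLinearMap.proj_apply, smul_eq_mul, h2,
    Finset.sum_add_distrib, mul_add, Finset.mul_sum]
  simp only [Pi.single_apply, mul_ite, mul_one, mul_zero, Finset.sum_ite_eq',
    Finset.mem_univ, if_true, h3]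
  have h4 : ∑ a, ∑ b, x a * (x b * fderiv ℝ (fun z => A z a b) x (Pi.single ν 1))
      = ∑ a, ∑ b, partialDeriv ν (fun z => A z a b) x * x a * x b :=
    Finset.sum_congr rfl fun a _ => Finset.sum_congr rfl fun b _ => by rw [partialDeriv]; ring
  rw [h4]
  ring

/-- The Gauss lemma: in normal coordinates, `C_{μν}(y) y^ν = η_{μν} y^ν`. -/
theorem gauss_lemma (hU : IsOpen U) (hs : StarConvex ℝ 0 U)
    (hdiff : ∀ y ∈ U, ∀ μ ν, DifferentiableAt ℝ (fun z => C z μ ν) y)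
    (hdet : ∀ y ∈ U, IsUnit (C y).det) (hsymm : ∀ y ∈ U, (C y).IsSymm) (h : IsNormalOn C U)
    {y : Spacetime n} (hy : y ∈ U) : C y *ᵥ y = minkowski n *ᵥ y := by
  have hmem : ∀ t ∈ Set.Icc (0 : ℝ) 1, t • y ∈ U := fun t ht => hs.smul_mem hy ht.1 ht.2
  have hηsymm : (minkowski n).IsSymm := by simp [minkowski, Matrix.IsSymm]
  ext ν
  -- The error `s (C(s y) y - η y)` vanishes at `s = 0`. Its derivative vanishes as well:
  -- differentiate `zᵀ C(z) z = zᵀ η z` at `t y`, insert the geodesic equation and divide by `t`; at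
  -- `t = 0` use `C(0) = η`.
  have hder : ∀ t ∈ Set.Icc (0 : ℝ) 1,
      HasDerivAt (fun s : ℝ => s * ((C (s • y) *ᵥ y) ν - (minkowski n *ᵥ y) ν)) 0 t := by
    intro t ht
    have h1 := (hasDerivAt_id t).fun_mul
      ((hasDerivAt_ray_mulVec (w := y) (hdiff _ (hmem t ht)) ν).sub_const ((minkowski n *ᵥ y) ν))
    convert! h1 using 1
    simp only [id, one_mul]
    rcases eq_or_ne t 0 with rfl | ht0
    · simp [h.at_origin]
    · have h2 : (fun z => z ⬝ᵥ (C z *ᵥ z)) =ᶠ[𝓝 (t • y)] fun z => z ⬝ᵥ (minkowski n *ᵥ z) := by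
        filter_upwards [hU.mem_nhds (hmem t ht)] with z hz
          using dotProduct_mulVec_self_eq hs hdiff hdet h hz
      have h3 := congrArg (fun L : Spacetime n →L[ℝ] ℝ => L (Pi.single ν 1)) h2.fderiv_eq
      rw [fderiv_quadratic (hsymm _ (hmem t ht)) (hdiff _ (hmem t ht)),
        fderiv_quadratic (A := fun _ => minkowski n) hηsymm
          (fun μ ν => differentiableAt_const _)] at h3
      have h4 : ∑ a, ∑ b, partialDeriv ν (fun z => C z a b) (t • y) * (t • y) a * (t • y) b
          = t ^ 2 * (2 * (directionalDeriv C (t • y) y *ᵥ y) ν) := by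
        rw [h.two_mul_directionalDeriv hdet (hmem t ht), Finset.mul_sum]
        refine Finset.sum_congr rfl fun a _ => ?_
        rw [Finset.mul_sum]
        refine Finset.sum_congr rfl fun b _ => ?_
        simp only [Pi.smul_apply, smul_eq_mul]
        ring
      have h5 : ∑ a, ∑ b, partialDeriv ν (fun _ : Spacetime n => minkowski n a b) (t • y)
          * (t • y) a * (t • y) b = 0 := by
        simp [partialDeriv]
      rw [h4, h5, mulVec_smul, mulVec_smul, Pi.smul_apply, Pi.smul_apply, smul_eq_mul,
        smul_eq_mul] at h3
      have h6 : t * (2 * ((C (t • y) *ᵥ y) ν - (minkowski n *ᵥ y) ν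
          + t * (directionalDeriv C (t • y) y *ᵥ y) ν)) = 0 := by linarith
      have h7 := (mul_eq_zero.1 h6).resolve_left ht0
      linarith
  have := eq_of_hasDerivAt_zero hder
  simpa [sub_eq_zero] using this

theorem gauss_lemma_ray (hU : IsOpen U) (hs : StarConvex ℝ 0 U)
    (hdiff : ∀ y ∈ U, ∀ μ ν, DifferentiableAt ℝ (fun z => C z μ ν) y)
    (hdet : ∀ y ∈ U, IsUnit (C y).det) (hsymm : ∀ y ∈ U, (C y).IsSymm) (h : IsNormalOn C U)
    {v : Spacetime n} {s : ℝ} (hs0 : s ≠ 0) (hv : s • v ∈ U) :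
    C (s • v) *ᵥ v = minkowski n *ᵥ v ∧ directionalDeriv C (s • v) v *ᵥ v = 0 := by
  have key : ∀ s : ℝ, s ≠ 0 → s • v ∈ U → C (s • v) *ᵥ v = minkowski n *ᵥ v := fun s hs0 hv => by
    have := gauss_lemma hU hs hdiff hdet hsymm h hv
    rw [mulVec_smul, mulVec_smul] at this
    exact smul_right_injective _ hs0 this
  refine ⟨key s hs0 hv, ?_⟩
  ext μ
  refine (hasDerivAt_ray_mulVec (hdiff _ hv) μ).unique ?_
  refine (hasDerivAt_const s ((minkowski n *ᵥ v) μ)).congr_of_eventuallyEq ?_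
  have hcont : ContinuousAt (fun s : ℝ => s • v) s := by fun_prop
  filter_upwards [hcont.eventually (hU.mem_nhds hv), isOpen_ne.mem_nhds hs0] with t ht ht0
  rw [key t ht0 ht]

end Gauss

/-! ### Logarithmic derivatives under conformal rescaling -/

section LogDeriv

variable {d : ℕ} {h : ℝ → Matrix (Fin d) (Fin d) ℝ} {r : ℝ}

theorem halfLogDeriv_sq_smul {ω : ℝ → ℝ} {ω' : ℝ} (hω : HasDerivAt ω ω' r) (h0 : ω r ≠ 0)
    (hh : ∀ A B, DifferentiableAt ℝ (fun s => h s A B) r) (hdet : IsUnit (h r).det) :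
    halfLogDeriv (fun s => ω s ^ 2 • h s) r
      = (ω' / ω r) • (1 : Matrix (Fin d) (Fin d) ℝ) + halfLogDeriv h r := by
  have h1 : of (fun A B => deriv (fun s => (ω s ^ 2 • h s) A B) r)
      = (2 * ω r * ω') • h r + ω r ^ 2 • of (fun A B => deriv (fun s => h s A B) r) := by
    ext A B
    have h2 := (hω.fun_pow 2).fun_mul (hh A B).hasDerivAt
    simp only [of_apply, Matrix.add_apply, Matrix.smul_apply, smul_eq_mul]
    rw [h2.deriv]
    norm_num
  have hu : ω r ^ 2 ≠ 0 := pow_ne_zero 2 h0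
  let := invertibleOfNonzero hu
  rw [halfLogDeriv, h1, Matrix.inv_smul _ _ hdet, invOf_eq_inv, Matrix.add_mul]
  simp only [Matrix.smul_mul, Matrix.mul_smul, mul_nonsing_inv _ hdet, smul_add, smul_smul,
    halfLogDeriv]
  congr 2
  · field_simp
  · field_simp

/-- Multiples of the identity drop out of the traceless part. The factor `r²` of the induced metric
is therefore invisible to the shear. -/
theorem shearSq_eq (hd : d ≠ 0) {H : Matrix (Fin d) (Fin d) ℝ} {c : ℝ}
    (hH : halfLogDeriv h r = c • (1 : Matrix (Fin d) (Fin d) ℝ) + H) :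
    shearSq h r = (H * H).trace - H.trace ^ 2 / d := by
  have hd' : (d : ℝ) ≠ 0 := by exact_mod_cast hd
  have h1 : shear h r = H - (H.trace / d) • (1 : Matrix (Fin d) (Fin d) ℝ) := by
    rw [shear, hH, trace_add, trace_smul, trace_one, Fintype.card_fin, smul_eq_mul, add_div,
      mul_div_cancel_right₀ _ hd', add_smul]
    abel
  rw [shearSq, h1, Matrix.sub_mul, Matrix.mul_sub, Matrix.mul_sub]
  simp only [Matrix.mul_smul, Matrix.smul_mul, Matrix.mul_one, Matrix.one_mul, trace_sub,
    trace_smul, trace_one, Fintype.card_fin, smul_eq_mul]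
  field_simp
  ring

end LogDeriv

/-! ### Divergence and shear as spacetime traces along a generator -/

section Generator

variable {n : ℕ} {C : TensorField n} {U : Set (Spacetime n)}

/-- A metric satisfying the Gauss lemma on the open set `U`. -/
structure IsGaussMetric (C : TensorField n) (U : Set (Spacetime n)) : Prop where
  differentiableAt : ∀ y ∈ U, ∀ μ ν, DifferentiableAt ℝ (fun z => C z μ ν) y
  isUnit_det : ∀ y ∈ U, IsUnit (C y).det
  isSymm : ∀ y ∈ U, (C y).IsSymm
  isSymm_directionalDeriv : ∀ y ∈ U, ∀ v, (directionalDeriv C y v).IsSymm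
  gauss : ∀ (v : Spacetime n) (s : ℝ), s ≠ 0 → s • v ∈ U →
    C (s • v) *ᵥ v = minkowski n *ᵥ v ∧ directionalDeriv C (s • v) v *ᵥ v = 0

theorem IsNormalOn.isGaussMetric {m : ℕ∞} (h : IsNormalOn C U) (hC : IsMetricOn m C U)
    (hm : 1 ≤ m) (hU : IsOpen U) (hs : StarConvex ℝ 0 U) : IsGaussMetric C U := by
  have hdiff : ∀ y ∈ U, ∀ μ ν, DifferentiableAt ℝ (fun z => C z μ ν) y := fun y hy μ ν =>
    ((hC.contDiffOn μ ν).differentiableOn (by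
      have : m ≠ 0 := (zero_lt_one.trans_le hm).ne'
      exact_mod_cast this)).differentiableAt (hU.mem_nhds hy)
  have hdet : ∀ y ∈ U, IsUnit (C y).det := fun y hy => (hC.lorentzian y hy).isUnit_det
  have hsymm : ∀ y ∈ U, (C y).IsSymm := fun y hy => (hC.lorentzian y hy).isSymm
  exact ⟨hdiff, hdet, hsymm, fun y hy v => isSymm_directionalDeriv hU hsymm hy v,
    fun v s hs0 hv => gauss_lemma_ray hU hs hdiff hdet hsymm h hs0 hv⟩

/-- The endomorphism `½ C^{-1} ∂_v C` at `y`. -/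
def logDeriv (C : TensorField n) (y v : Spacetime n) : Matrix (Fin (n + 1)) (Fin (n + 1)) ℝ :=
  (1 / 2 : ℝ) • ((C y)⁻¹ * directionalDeriv C y v)

variable {Θ : Fin n → ℝ} {e : Fin (n - 1) → Fin n → ℝ} {r : ℝ}

/-- The metric of the screen space of the generator through `Θ`. -/
def screenMetric (C : TensorField n) (Θ : Fin n → ℝ) (e : Fin (n - 1) → Fin n → ℝ) (r : ℝ) :
    Matrix (Fin (n - 1)) (Fin (n - 1)) ℝ :=
  frameMatrix e * C (conePoint r Θ) * (frameMatrix e)ᵀ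

theorem frameMatrix_mul_mul_apply (M : Matrix (Fin (n + 1)) (Fin (n + 1)) ℝ) (A B : Fin (n - 1)) :
    (frameMatrix e * M * (frameMatrix e)ᵀ) A B
      = ∑ μ, ∑ ν, M μ ν * frameMatrix e A μ * frameMatrix e B ν := by
  simp only [mul_apply, transpose_apply, Finset.sum_mul]
  rw [Finset.sum_comm]
  exact Finset.sum_congr rfl fun μ _ => Finset.sum_congr rfl fun ν _ => by ring

theorem inducedMetric_eq : inducedMetric C Θ e = fun s => s ^ 2 • screenMetric C Θ e s := by
  ext s A B
  rw [inducedMetric, of_apply, Matrix.smul_apply, screenMetric, frameMatrix_mul_mul_apply,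
    Fin.sum_univ_succ]
  simp [Fin.sum_univ_succ]

theorem hasDerivAt_screenMetric (hC : IsGaussMetric C U) (hr : conePoint r Θ ∈ U)
    (A B : Fin (n - 1)) :
    HasDerivAt (fun s => screenMetric C Θ e s A B)
      ((frameMatrix e * directionalDeriv C (conePoint r Θ) (conePoint 1 Θ) *
        (frameMatrix e)ᵀ) A B) r := by
  simp only [screenMetric, frameMatrix_mul_mul_apply]
  refine HasDerivAt.fun_sum fun μ _ => HasDerivAt.fun_sum fun ν _ => ?_
  refine HasDerivAt.mul_const (HasDerivAt.mul_const ?_ _) _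
  have h1 := hC.differentiableAt _ hr μ ν
  rw [conePoint_eq_smul_one] at h1
  have h2 := hasDerivAt_ray h1
  simp only [← conePoint_eq_smul_one] at h2
  exact h2

theorem IsGaussMetric.isUnit_det_screenMetric (hC : IsGaussMetric C U) (he : IsFrame Θ e)
    (hr0 : r ≠ 0) (hr : conePoint r Θ ∈ U) : IsUnit (screenMetric C Θ e r).det := by
  refine he.isUnit_det (hC.isSymm _ hr) (hC.isUnit_det _ hr) ?_
  rw [conePoint_eq_smul_one] at hr ⊢
  exact (hC.gauss _ _ hr0 hr).1

/-- The right-hand sides no longer involve the frame; this is what lets the coefficients extend off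
the cone. -/
theorem IsGaussMetric.trace_halfLogDeriv (hC : IsGaussMetric C U) (he : IsFrame Θ e)
    (hr0 : r ≠ 0) (hr : conePoint r Θ ∈ U) :
    (halfLogDeriv (screenMetric C Θ e) r).trace
        = (logDeriv C (conePoint r Θ) (conePoint 1 Θ)).trace ∧
      (halfLogDeriv (screenMetric C Θ e) r * halfLogDeriv (screenMetric C Θ e) r).trace
        = (logDeriv C (conePoint r Θ) (conePoint 1 Θ) *
          logDeriv C (conePoint r Θ) (conePoint 1 Θ)).trace := by
  have hg := hC.gauss (conePoint 1 Θ) r hr0 (by rwa [← conePoint_eq_smul_one])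
  rw [← conePoint_eq_smul_one] at hg
  have key := he.trace_eq (hC.isSymm _ hr) (hC.isUnit_det _ hr) hg.1
    (hC.isSymm_directionalDeriv _ hr _) hg.2
  have h1 : of (fun A B => deriv (fun s => screenMetric C Θ e s A B) r)
      = frameMatrix e * directionalDeriv C (conePoint r Θ) (conePoint 1 Θ) *
        (frameMatrix e)ᵀ := by
    ext A B
    exact (hasDerivAt_screenMetric hC hr A B).deriv
  rw [halfLogDeriv, h1, logDeriv]
  simp only [trace_smul, Matrix.smul_mul, Matrix.mul_smul]
  rw [key.1, key.2]
  exact ⟨rfl, rfl⟩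

theorem cast_pred (hn : 2 ≤ n) : ((n - 1 : ℕ) : ℝ) = (n : ℝ) - 1 := by
  rw [Nat.cast_sub (by omega), Nat.cast_one]

theorem IsGaussMetric.shearSq_inducedMetric (hn : 2 ≤ n) (hC : IsGaussMetric C U)
    (he : IsFrame Θ e) (hr0 : r ≠ 0) (hr : conePoint r Θ ∈ U) :
    shearSq (inducedMetric C Θ e) r
      = (logDeriv C (conePoint r Θ) (conePoint 1 Θ) *
          logDeriv C (conePoint r Θ) (conePoint 1 Θ)).trace
        - (logDeriv C (conePoint r Θ) (conePoint 1 Θ)).trace ^ 2 / ((n : ℝ) - 1) := by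
  have h1 := halfLogDeriv_sq_smul (hasDerivAt_id r) hr0
    (fun A B => (hasDerivAt_screenMetric (e := e) hC hr A B).differentiableAt)
    (hC.isUnit_det_screenMetric he hr0 hr)
  simp only [id] at h1
  have h2 := hC.trace_halfLogDeriv he hr0 hr
  rw [inducedMetric_eq, shearSq_eq (by omega) h1, h2.1, h2.2, cast_pred hn]

theorem IsGaussMetric.divergence_rescaledMetric (hn : 2 ≤ n) (hC : IsGaussMetric C U)
    (he : IsFrame Θ e) (hr0 : r ≠ 0) (hr : conePoint r Θ ∈ U) {Ω : Spacetime n → ℝ} {ω' : ℝ}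
    (hΩ : HasDerivAt (fun s => Ω (conePoint s Θ)) ω' r) (hΩ0 : Ω (conePoint r Θ) ≠ 0) :
    divergence (rescaledMetric C Ω Θ e) r
      = ((n : ℝ) - 1) * (1 / r + ω' / Ω (conePoint r Θ))
        + (logDeriv C (conePoint r Θ) (conePoint 1 Θ)).trace := by
  have h0 : rescaledMetric C Ω Θ e
      = fun s => (Ω (conePoint s Θ) * s) ^ 2 • screenMetric C Θ e s := by
    funext s
    rw [rescaledMetric, inducedMetric_eq, smul_smul, mul_pow]
  have h1 := halfLogDeriv_sq_smul (hΩ.fun_mul (hasDerivAt_id r)) (mul_ne_zero hΩ0 hr0)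
    (fun A B => (hasDerivAt_screenMetric (e := e) hC hr A B).differentiableAt)
    (hC.isUnit_det_screenMetric he hr0 hr)
  simp only [id] at h1
  have h2 := hC.trace_halfLogDeriv he hr0 hr
  rw [divergence, h0, h1, trace_add, h2.1, trace_smul, trace_one, Fintype.card_fin, cast_pred hn,
    smul_eq_mul]
  congr 1
  field_simp
  ring

end Generator

/-! ### The coefficients along the segment to an arbitrary point of `U` -/

section Rays

variable {n : ℕ} {C : TensorField n} {U : Set (Spacetime n)}

theorem contDiffOn_det {d : ℕ} {m : WithTop ℕ∞} {M : Spacetime n → Matrix (Fin d) (Fin d) ℝ}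
    (hM : ∀ a b, ContDiffOn ℝ m (fun y => M y a b) U) : ContDiffOn ℝ m (fun y => (M y).det) U := by
  simp only [det_apply]
  exact ContDiffOn.sum fun σ _ => (contDiffOn_prod fun i _ => hM _ _).const_smul _

theorem contDiffOn_inv {d : ℕ} {m : WithTop ℕ∞} {M : Spacetime n → Matrix (Fin d) (Fin d) ℝ}
    (hM : ∀ a b, ContDiffOn ℝ m (fun y => M y a b) U) (hdet : ∀ y ∈ U, IsUnit (M y).det)
    (a b : Fin d) : ContDiffOn ℝ m (fun y => (M y)⁻¹ a b) U := by
  simp only [inv_def, Matrix.smul_apply, smul_eq_mul, Ring.inverse_eq_inv', adjugate_apply]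
  refine ((contDiffOn_det hM).inv fun y hy => (hdet y hy).ne_zero).mul (contDiffOn_det fun i j => ?_)
  by_cases h : i = b
  · subst h
    simpa using contDiffOn_const
  · simpa [updateRow_ne h] using hM i j

/-- The components of `logDeriv C y`, as linear forms. -/
def logDerivForm (C : TensorField n) (a b : Fin (n + 1)) (y : Spacetime n) :
    Spacetime n →L[ℝ] ℝ :=
  ∑ c, (1 / 2 * (C y)⁻¹ a c) • fderiv ℝ (fun z => C z c b) y

theorem logDerivForm_apply (a b : Fin (n + 1)) (y v : Spacetime n) :
    logDerivForm C a b y v = logDeriv C y v a b := by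
  simp only [logDerivForm, logDeriv, directionalDeriv, Matrix.smul_apply, mul_apply, of_apply,
    _root_.sum_apply, _root_.smul_apply, smul_eq_mul, Finset.mul_sum, mul_assoc]

theorem contDiffOn_logDerivForm {k : ℕ∞} (hU : IsOpen U) (hC : IsMetricOn (k + 1) C U)
    (a b : Fin (n + 1)) : ContDiffOn ℝ k (logDerivForm C a b) U := by
  refine ContDiffOn.sum fun c _ => ContDiffOn.fun_smul (contDiffOn_const.mul ?_) ?_
  · exact contDiffOn_inv (fun a b => (hC.contDiffOn a b).of_le (by exact_mod_cast le_self_add))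
      (fun y hy => (hC.lorentzian y hy).isUnit_det) _ _
  · exact (hC.contDiffOn c b).fderiv_of_isOpen hU (by exact_mod_cast le_rfl)

/-- The components of `½ C^{-1} ∂_y C` along the segment from the origin to `y`. -/
def logDerivRay (C : TensorField n) (a b : Fin (n + 1)) (y : Spacetime n) : C(unitInterval, ℝ) :=
  pathApply 1 (rayMap (logDerivForm C a b) y) y

theorem contDiffOn_logDerivRay {k : ℕ∞} (hU : IsOpen U) (hs : StarConvex ℝ 0 U)
    (hC : IsMetricOn (k + 1) C U) (a b : Fin (n + 1)) : ContDiffOn ℝ k (logDerivRay C a b) U :=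
  ((ContinuousLinearMap.contDiff _).comp_contDiffOn
    (contDiffOn_rayMap hU hs k (contDiffOn_logDerivForm hU hC a b))).clm_apply contDiffOn_id

theorem logDerivRay_apply {k : ℕ∞} (hU : IsOpen U) (hs : StarConvex ℝ 0 U)
    (hC : IsMetricOn (k + 1) C U) (a b : Fin (n + 1)) {y : Spacetime n} (hy : y ∈ U)
    (t : unitInterval) : logDerivRay C a b y t = logDeriv C ((t : ℝ) • y) y a b := by
  rw [logDerivRay, pathApply_apply,
    (rayMap_spec hs (contDiffOn_logDerivForm hU hC a b).continuousOn).2 y hy, logDerivForm_apply]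
  simp

/-- The trace of `½ C^{-1} ∂_y C` along the segment from the origin to `y`. -/
def expansionRay (C : TensorField n) (y : Spacetime n) : C(unitInterval, ℝ) :=
  ∑ a, logDerivRay C a a y

/-- The shear term of the Raychaudhuri equation along the segment from the origin to `y`. -/
def focusingRay (C : TensorField n) (y : Spacetime n) : C(unitInterval, ℝ) :=
  -- The outer factor comes from the linearisation, whose zeroth-order coefficient is `|σ|² / (n -
  -- 1)`.
  ((n : ℝ) - 1)⁻¹ • (∑ a, ∑ b, logDerivRay C a b y * logDerivRay C b a y
    - ((n : ℝ) - 1)⁻¹ • expansionRay C y ^ 2)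

theorem contDiffOn_expansionRay {k : ℕ∞} (hU : IsOpen U) (hs : StarConvex ℝ 0 U)
    (hC : IsMetricOn (k + 1) C U) : ContDiffOn ℝ k (expansionRay C) U :=
  ContDiffOn.sum fun a _ => contDiffOn_logDerivRay hU hs hC a a

theorem contDiffOn_focusingRay {k : ℕ∞} (hU : IsOpen U) (hs : StarConvex ℝ 0 U)
    (hC : IsMetricOn (k + 1) C U) : ContDiffOn ℝ k (focusingRay C) U :=
  ((ContDiffOn.sum fun a _ => ContDiffOn.sum fun b _ =>
    (contDiffOn_logDerivRay hU hs hC a b).mul (contDiffOn_logDerivRay hU hs hC b a)).sub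
    (((contDiffOn_expansionRay hU hs hC).pow 2).const_smul _)).const_smul _

theorem expansionRay_apply {k : ℕ∞} (hU : IsOpen U) (hs : StarConvex ℝ 0 U)
    (hC : IsMetricOn (k + 1) C U) {y : Spacetime n} (hy : y ∈ U) (t : unitInterval) :
    expansionRay C y t = (logDeriv C ((t : ℝ) • y) y).trace := by
  rw [expansionRay, ContinuousMap.sum_apply]
  exact Finset.sum_congr rfl fun a _ => logDerivRay_apply hU hs hC a a hy t

theorem focusingRay_apply {k : ℕ∞} (hU : IsOpen U) (hs : StarConvex ℝ 0 U)
    (hC : IsMetricOn (k + 1) C U) {y : Spacetime n} (hy : y ∈ U) (t : unitInterval) :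
    focusingRay C y t = ((logDeriv C ((t : ℝ) • y) y * logDeriv C ((t : ℝ) • y) y).trace
      - (logDeriv C ((t : ℝ) • y) y).trace ^ 2 / ((n : ℝ) - 1)) / ((n : ℝ) - 1) := by
  simp only [focusingRay, ContinuousMap.smul_apply, ContinuousMap.sub_apply,
    ContinuousMap.sum_apply, ContinuousMap.mul_apply, ContinuousMap.pow_apply,
    expansionRay_apply hU hs hC hy, logDerivRay_apply hU hs hC _ _ hy, smul_eq_mul, trace, diag,
    Matrix.mul_apply, div_eq_inv_mul]

theorem logDerivRay_zero (a b : Fin (n + 1)) : logDerivRay C a b 0 = 0 := map_zero _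

theorem expansionRay_zero : expansionRay C 0 = 0 := by simp [expansionRay, logDerivRay_zero]

theorem focusingRay_zero : focusingRay C 0 = 0 := by
  simp [focusingRay, expansionRay_zero, logDerivRay_zero]

theorem logDeriv_smul (c : ℝ) (y v : Spacetime n) : logDeriv C y (c • v) = c • logDeriv C y v := by
  have : directionalDeriv C y (c • v) = c • directionalDeriv C y v := by
    ext a b
    simp [directionalDeriv]
  rw [logDeriv, this, Matrix.mul_smul, smul_comm, logDeriv]

end Rays

/-! ### Polar form of points of the light-cone -/

section Cone

variable {n : ℕ} {Θ : Fin n → ℝ}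

theorem exists_eq_conePoint {y : Spacetime n} (hy : y ∈ cone n) (hy0 : y ≠ 0) :
    ∃ (ρ : ℝ) (Θ : Fin n → ℝ), 0 < ρ ∧ ∑ i, Θ i ^ 2 = 1 ∧ y = conePoint ρ Θ := by
  have hy' : y 0 = Real.sqrt (∑ i : Fin n, y i.succ ^ 2) := hy
  have hsq : y 0 ^ 2 = ∑ i : Fin n, y i.succ ^ 2 := by
    rw [hy', Real.sq_sqrt (Finset.sum_nonneg fun i _ => sq_nonneg _)]
  have hnonneg : 0 ≤ y 0 := hy' ▸ Real.sqrt_nonneg _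
  have hpos : 0 < y 0 := by
    refine lt_of_le_of_ne hnonneg fun h0 => hy0 ?_
    rw [← h0, zero_pow two_ne_zero] at hsq
    have h1 := (Finset.sum_eq_zero_iff_of_nonneg fun (i : Fin n) _ => sq_nonneg (y i.succ)).1
      hsq.symm
    ext i
    refine Fin.cases h0.symm (fun i => ?_) i
    simpa using h1 i (Finset.mem_univ i)
  refine ⟨y 0, fun i => y i.succ / y 0, hpos, ?_, ?_⟩
  · simp only [div_pow]
    rw [← Finset.sum_div, ← hsq, div_self (pow_ne_zero 2 hpos.ne')]
  · ext i
    refine Fin.cases (by simp) (fun i => ?_) i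
    rw [conePoint_succ, mul_div_cancel₀ _ hpos.ne']

theorem conePoint_mem_cone (hΘ : ∑ i, Θ i ^ 2 = 1) {r : ℝ} (hr : 0 ≤ r) :
    conePoint r Θ ∈ cone n := by
  change conePoint r Θ 0 = Real.sqrt (∑ i : Fin n, conePoint r Θ i.succ ^ 2)
  simp only [conePoint_zero, conePoint_succ, mul_pow]
  rw [← Finset.mul_sum, hΘ, mul_one, Real.sqrt_sq hr]

theorem conePoint_ne_zero {r : ℝ} (hr : 0 < r) : conePoint r Θ ≠ 0 := fun h => by
  have := congrFun h 0
  exact hr.ne' this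

theorem continuous_conePoint : Continuous fun r : ℝ => conePoint r Θ := by
  have h : (fun r : ℝ => conePoint r Θ) = fun r => r • conePoint 1 Θ :=
    funext fun r => conePoint_eq_smul_one r
  rw [h]
  fun_prop

end Cone

/-! ### The conformal factor: regularity, uniqueness and existence -/

section Data

variable {n : ℕ} {k : ℕ∞} {U : Set (Spacetime n)} {C : TensorField n} {κ f : Spacetime n → ℝ}

/-- The data of the Raychaudhuri equation on the light-cone: a metric in normal coordinates and
a function `κ` on the light-cone such that `r κ` extends to a regular function `f`. -/
structure IsConeData (k : ℕ∞) (U : Set (Spacetime n)) (C : TensorField n)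
    (κ f : Spacetime n → ℝ) : Prop where
  two_le : 2 ≤ n
  isOpen : IsOpen U
  zero_mem : (0 : Spacetime n) ∈ U
  starConvex : StarConvex ℝ 0 U
  isMetricOn : IsMetricOn (k + 1) C U
  isNormalOn : IsNormalOn C U
  contDiffOn : ContDiffOn ℝ k f U
  isBigO : f =O[𝓝 0] fun y => ‖y‖ ^ 2
  mul_eq : ∀ y ∈ cone n ∩ U, y 0 * κ y = f y

namespace IsConeData

theorem isGaussMetric (h : IsConeData k U C κ f) : IsGaussMetric C U :=
  h.isNormalOn.isGaussMetric h.isMetricOn le_add_self h.isOpen h.starConvex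

theorem sub_one_ne_zero (h : IsConeData k U C κ f) : (n : ℝ) - 1 ≠ 0 := by
  have : (2 : ℝ) ≤ n := by exact_mod_cast h.two_le
  linarith

theorem apply_zero (h : IsConeData k U C κ f) : f 0 = 0 := by
  obtain ⟨c, hc⟩ := h.isBigO.bound
  simpa using hc.self_of_nhds

theorem extend_rayQuotient (h : IsConeData k U C κ f) {y : Spacetime n} (hy : y ∈ U) {t : ℝ}
    (ht : t ∈ Set.Icc (0 : ℝ) 1) : extend (rayQuotient f y) t = t⁻¹ * f (t • y) := by
  rw [extend_of_mem _ ht, (rayQuotient_spec h.isOpen h.starConvex h.contDiffOn.continuousOn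
    h.isBigO).2 y hy, smul_eq_mul]

theorem extend_expansionRay (h : IsConeData k U C κ f) {y : Spacetime n} (hy : y ∈ U) {t : ℝ}
    (ht : t ∈ Set.Icc (0 : ℝ) 1) :
    extend (expansionRay C y) t = (logDeriv C (t • y) y).trace := by
  rw [extend_of_mem _ ht, expansionRay_apply h.isOpen h.starConvex h.isMetricOn hy]

theorem extend_focusingRay (h : IsConeData k U C κ f) {y : Spacetime n} (hy : y ∈ U) {t : ℝ}
    (ht : t ∈ Set.Icc (0 : ℝ) 1) :
    extend (focusingRay C y) t = ((logDeriv C (t • y) y * logDeriv C (t • y) y).trace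
      - (logDeriv C (t • y) y).trace ^ 2 / ((n : ℝ) - 1)) / ((n : ℝ) - 1) := by
  rw [extend_of_mem _ ht, focusingRay_apply h.isOpen h.starConvex h.isMetricOn hy]

section Scaling

variable {y : Spacetime n} {c t : ℝ}

theorem mul_mem_Icc (hc : c ∈ Set.Ioo (0 : ℝ) 1) (ht : t ∈ Set.Icc (0 : ℝ) 1) :
    c * t ∈ Set.Icc (0 : ℝ) 1 :=
  ⟨mul_nonneg hc.1.le ht.1, mul_le_one₀ hc.2.le ht.1 ht.2⟩

theorem smul_mem (h : IsConeData k U C κ f) (hy : y ∈ U) (ht : t ∈ Set.Icc (0 : ℝ) 1) :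
    t • y ∈ U := h.starConvex.smul_mem hy ht.1 ht.2

/-- With the two lemmas after it, this records how the coefficients change under `t ↦ c t`: by `c`
at first order and `c²` at zeroth order, as the equation requires. -/
theorem extend_rayQuotient_smul (h : IsConeData k U C κ f) (hy : y ∈ U)
    (hc : c ∈ Set.Ioo (0 : ℝ) 1) (ht : t ∈ Set.Icc (0 : ℝ) 1) :
    extend (rayQuotient f (c • y)) t = c * extend (rayQuotient f y) (c * t) := by
  rw [h.extend_rayQuotient (h.smul_mem hy (Set.Ioo_subset_Icc_self hc)) ht,
    h.extend_rayQuotient hy (mul_mem_Icc hc ht), smul_smul, mul_comm t c, mul_inv, ← mul_assoc,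
    ← mul_assoc, mul_inv_cancel₀ hc.1.ne', one_mul]

theorem extend_expansionRay_smul (h : IsConeData k U C κ f) (hy : y ∈ U)
    (hc : c ∈ Set.Ioo (0 : ℝ) 1) (ht : t ∈ Set.Icc (0 : ℝ) 1) :
    extend (expansionRay C (c • y)) t = c * extend (expansionRay C y) (c * t) := by
  rw [h.extend_expansionRay (h.smul_mem hy (Set.Ioo_subset_Icc_self hc)) ht,
    h.extend_expansionRay hy (mul_mem_Icc hc ht), smul_smul, mul_comm t c, logDeriv_smul,
    Matrix.trace_smul, smul_eq_mul]

theorem extend_focusingRay_smul (h : IsConeData k U C κ f) (hy : y ∈ U)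
    (hc : c ∈ Set.Ioo (0 : ℝ) 1) (ht : t ∈ Set.Icc (0 : ℝ) 1) :
    extend (focusingRay C (c • y)) t = c ^ 2 * extend (focusingRay C y) (c * t) := by
  rw [h.extend_focusingRay (h.smul_mem hy (Set.Ioo_subset_Icc_self hc)) ht,
    h.extend_focusingRay hy (mul_mem_Icc hc ht), smul_smul, mul_comm t c, logDeriv_smul]
  simp only [Matrix.trace_smul, Matrix.smul_mul, Matrix.mul_smul, smul_eq_mul]
  ring

end Scaling

section Generator

variable {Θ : Fin n → ℝ} {e : Fin (n - 1) → Fin n → ℝ} {ρ t : ℝ}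

theorem conePoint_mem (h : IsConeData k U C κ f) (hy : conePoint ρ Θ ∈ U)
    (ht : t ∈ Set.Icc (0 : ℝ) 1) : conePoint (t * ρ) Θ ∈ U := by
  rw [conePoint_eq_smul]
  exact h.smul_mem hy ht

theorem extend_rayQuotient_conePoint (h : IsConeData k U C κ f) (hΘ : ∑ i, Θ i ^ 2 = 1)
    (hρ : 0 < ρ) (hy : conePoint ρ Θ ∈ U) (ht : t ∈ Set.Ioo (0 : ℝ) 1) :
    extend (rayQuotient f (conePoint ρ Θ)) t = ρ * κ (conePoint (t * ρ) Θ) := by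
  have ht' := Set.Ioo_subset_Icc_self ht
  rw [h.extend_rayQuotient hy ht', ← conePoint_eq_smul,
    ← h.mul_eq _ ⟨conePoint_mem_cone hΘ (mul_pos ht.1 hρ).le, h.conePoint_mem hy ht'⟩,
    conePoint_zero, ← mul_assoc, ← mul_assoc, inv_mul_cancel₀ ht.1.ne', one_mul]

theorem extend_expansionRay_conePoint (h : IsConeData k U C κ f)
    (hy : conePoint ρ Θ ∈ U) (ht : t ∈ Set.Ioo (0 : ℝ) 1) :
    extend (expansionRay C (conePoint ρ Θ)) t
      = ρ * (logDeriv C (conePoint (t * ρ) Θ) (conePoint 1 Θ)).trace := by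
  rw [h.extend_expansionRay hy (Set.Ioo_subset_Icc_self ht), ← conePoint_eq_smul]
  conv_lhs => rw [conePoint_eq_smul_one ρ]
  rw [logDeriv_smul, Matrix.trace_smul, smul_eq_mul]

theorem extend_focusingRay_conePoint (h : IsConeData k U C κ f) (he : IsFrame Θ e) (hρ : 0 < ρ)
    (hy : conePoint ρ Θ ∈ U) (ht : t ∈ Set.Ioo (0 : ℝ) 1) :
    extend (focusingRay C (conePoint ρ Θ)) t
      = ρ ^ 2 * shearSq (inducedMetric C Θ e) (t * ρ) / ((n : ℝ) - 1) := by
  rw [h.extend_focusingRay hy (Set.Ioo_subset_Icc_self ht), ← conePoint_eq_smul,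
    h.isGaussMetric.shearSq_inducedMetric h.two_le he (mul_pos ht.1 hρ).ne'
      (h.conePoint_mem hy (Set.Ioo_subset_Icc_self ht))]
  have : logDeriv C (conePoint (t * ρ) Θ) (conePoint ρ Θ)
      = ρ • logDeriv C (conePoint (t * ρ) Θ) (conePoint 1 Θ) := by
    conv_lhs => rw [conePoint_eq_smul_one ρ]
    rw [logDeriv_smul]
  rw [this]
  simp only [Matrix.trace_smul, Matrix.smul_mul, Matrix.mul_smul, smul_eq_mul]
  ring

end Generator

end IsConeData

/-- The solution of the linearised Raychaudhuri equation along the segment from `0` to `y`. -/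
def raySolution (C : TensorField n) (f : Spacetime n → ℝ) (y : Spacetime n) :
    C(unitInterval, ℝ) := position (rayQuotient f y) (focusingRay C y)

/-- The derivative of `raySolution`. -/
def rayVelocity (C : TensorField n) (f : Spacetime n → ℝ) (y : Spacetime n) :
    C(unitInterval, ℝ) := velocity (rayQuotient f y) (focusingRay C y)

/-- The regular extension of the conformal factor off the light-cone. -/
def conformalExtension (C : TensorField n) (f : Spacetime n → ℝ) (y : Spacetime n) : ℝ :=
  raySolution C f y 1 * Real.exp (-((n : ℝ) - 1)⁻¹ * primitive (expansionRay C y) 1)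

namespace IsConeData

theorem contDiffOn_rayVelocity (h : IsConeData k U C κ f) :
    ContDiffOn ℝ k (rayVelocity C f) U := by
  have h1 : ContDiffOn ℝ k (fun y => (rayQuotient f y, focusingRay C y)) U :=
    (contDiffOn_rayQuotient h.isOpen h.starConvex k h.contDiffOn h.isBigO).prodMk
      (contDiffOn_focusingRay h.isOpen h.starConvex h.isMetricOn)
  have h2 := (contDiff_velocity (m := k)).comp_contDiffOn h1
  exact h2

theorem contDiffOn_conformalExtension (h : IsConeData k U C κ f) :
    ContDiffOn ℝ k (conformalExtension C f) U := by
  have hev : ∀ {g : Spacetime n → C(unitInterval, ℝ)}, ContDiffOn ℝ k g U →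
      ContDiffOn ℝ k (fun y => primitive (g y) 1) U := fun hg =>
    ((ContinuousMap.evalCLM ℝ (1 : unitInterval)).comp primitive).contDiff.comp_contDiffOn hg
  exact (hev h.contDiffOn_rayVelocity).mul (Real.contDiff_exp.comp_contDiffOn
    (contDiffOn_const.mul (hev (contDiffOn_expansionRay h.isOpen h.starConvex h.isMetricOn))))

theorem rayVelocity_zero (h : IsConeData k U C κ f) : rayVelocity C f 0 = 1 := by
  have h1 : rayQuotient f 0 = 0 := by
    ext t
    rw [(rayQuotient_spec h.isOpen h.starConvex h.contDiffOn.continuousOn h.isBigO).2 0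
      h.zero_mem t, smul_zero, h.apply_zero, smul_zero, ContinuousMap.zero_apply]
  rw [rayVelocity, h1, focusingRay_zero, velocity_zero_zero]

theorem conformalExtension_zero (h : IsConeData k U C κ f) : conformalExtension C f 0 = 1 := by
  have h1 : raySolution C f 0 1 = 1 := by
    change primitive (rayVelocity C f 0) 1 = 1
    have h2 : extend (1 : C(unitInterval, ℝ)) = fun _ => 1 := rfl
    rw [h.rayVelocity_zero, primitive_apply, h2]
    simp
  rw [conformalExtension, h1, expansionRay_zero]
  simp

/-- A conformal factor is determined on the light-cone by the data. -/
theorem eq_conformalExtension (h : IsConeData k U C κ f) {V : Set (Spacetime n)}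
    (hVs : StarConvex ℝ 0 V) (hVU : V ⊆ U) {Ω : Spacetime n → ℝ}
    (hΩ : IsConformalFactor C κ V Ω) {y : Spacetime n} (hy : y ∈ cone n ∩ V) (hy0 : y ≠ 0) :
    Ω y = conformalExtension C f y := by
  obtain ⟨ρ, Θ, hρ, hΘ, rfl⟩ := exists_eq_conePoint hy.1 hy0
  obtain ⟨e, he⟩ := exists_isFrame hΘ
  have hyV := hy.2
  have hyU := hVU hyV
  have hn := h.sub_one_ne_zero
  set y := conePoint ρ Θ
  set τ := divergence (rescaledMetric C Ω Θ e)
  have hmem : ∀ t : ℝ, 0 < t → t ≤ 1 → conePoint (t * ρ) Θ ∈ V := fun t h0 h1 => by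
    rw [conePoint_eq_smul]
    exact hVs.smul_mem hyV h0.le h1
  have hΩpos : ∀ t : ℝ, 0 < t → t ≤ 1 → 0 < Ω (conePoint (t * ρ) Θ) := fun t h0 h1 =>
    hΩ.pos _ ⟨conePoint_mem_cone hΘ (mul_pos h0 hρ).le, hmem t h0 h1⟩
      (conePoint_ne_zero (mul_pos h0 hρ))
  have hΩd : ∀ t : ℝ, 0 < t → t ≤ 1 → HasDerivAt (fun s => Ω (conePoint (s * ρ) Θ))
      (deriv (fun s => Ω (conePoint s Θ)) (t * ρ) * ρ) t := fun t h0 h1 => by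
    have h2 := (hΩ.differentiableAt Θ hΘ _ (mul_pos h0 hρ) (hmem t h0 h1)).hasDerivAt
    exact h2.comp t (hasDerivAt_mul_const ρ)
  set P : ℝ → ℝ := fun t => ∫ s in (0 : ℝ)..t, extend (expansionRay C y) s
  have hP : ∀ t, HasDerivAt P (extend (expansionRay C y) t) t := hasDerivAt_integral_extend _
  -- The linearising variable in the parameter `t = r / ρ`: its logarithmic derivative is `ρ τ / (n
  -- - 1)`.
  set u : ℝ → ℝ := fun t =>
    t * Ω (conePoint (t * ρ) Θ) * Real.exp (((n : ℝ) - 1)⁻¹ * P t) with hu_def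
  have hu : ∀ t : ℝ, t ∈ Set.Ioo (0 : ℝ) 1 →
      HasDerivAt u (u t * (((n : ℝ) - 1)⁻¹ * (ρ * τ (t * ρ)))) t := by
    intro t ht
    have h1 := (((hasDerivAt_id t).fun_mul (hΩd t ht.1 ht.2.le)).fun_mul
      ((hP t).const_mul ((n : ℝ) - 1)⁻¹).exp)
    have hτ : τ (t * ρ) = _ := h.isGaussMetric.divergence_rescaledMetric h.two_le he
      (mul_pos ht.1 hρ).ne' (hVU (hmem t ht.1 ht.2.le))
      (hΩ.differentiableAt Θ hΘ _ (mul_pos ht.1 hρ) (hmem t ht.1 ht.2.le)).hasDerivAt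
      (hΩpos t ht.1 ht.2.le).ne'
    convert! h1 using 1
    rw [hτ, h.extend_expansionRay_conePoint hyU ht, hu_def]
    have h2 := (hΩpos t ht.1 ht.2.le).ne'
    have h3 := ht.1.ne'
    simp only [id]
    field_simp
  have hv : ∀ t : ℝ, t ∈ Set.Ioo (0 : ℝ) 1 →
      HasDerivAt (fun t => u t * (((n : ℝ) - 1)⁻¹ * (ρ * τ (t * ρ))))
        (extend (rayQuotient f y) t * (u t * (((n : ℝ) - 1)⁻¹ * (ρ * τ (t * ρ))))
          - extend (focusingRay C y) t * u t) t := by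
    intro t ht
    obtain ⟨τ', hτ', hray⟩ := hΩ.raychaudhuri Θ e he _ (mul_pos ht.1 hρ) (hmem t ht.1 ht.2.le)
    have h1 : HasDerivAt (fun s => τ (s * ρ)) (τ' * ρ) t :=
      HasDerivAt.comp (h₂ := τ) (h := fun s => s * ρ) t hτ' (hasDerivAt_mul_const ρ)
    convert! (hu t ht).fun_mul ((h1.const_mul ρ).const_mul ((n : ℝ) - 1)⁻¹) using 1
    rw [h.extend_rayQuotient_conePoint hΘ hρ hyU ht, h.extend_focusingRay_conePoint he hρ hyU ht]
    have h2 : τ' = κ (conePoint (t * ρ) Θ) * τ (t * ρ) - τ (t * ρ) ^ 2 / ((n : ℝ) - 1)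
        - shearSq (inducedMetric C Θ e) (t * ρ) := by linarith
    rw [h2]
    field_simp
    ring
  have hpos : ∀ t ∈ Set.Ioo (0 : ℝ) 1, 0 < u t := fun t ht =>
    mul_pos (mul_pos ht.1 (hΩpos t ht.1 ht.2.le)) (Real.exp_pos _)
  have hlim : Tendsto (fun t => u t / t) (𝓝[>] 0) (𝓝 1) := by
    have h1 : Tendsto (fun t : ℝ => t * ρ) (𝓝[>] 0) (𝓝[>] 0) := by
      refine tendsto_nhdsWithin_iff.2 ⟨?_, ?_⟩
      · have : Tendsto (fun t : ℝ => t * ρ) (𝓝 0) (𝓝 (0 * ρ)) := by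
          exact (continuous_id.mul continuous_const).tendsto 0
        rw [zero_mul] at this
        exact this.mono_left nhdsWithin_le_nhds
      · filter_upwards [self_mem_nhdsWithin] with t ht using mul_pos ht hρ
    have h2 : Tendsto (fun t => Real.exp (((n : ℝ) - 1)⁻¹ * P t)) (𝓝[>] 0) (𝓝 1) := by
      have h3 := ((hP 0).const_mul ((n : ℝ) - 1)⁻¹).exp.continuousAt.tendsto
      have h4 : P 0 = 0 := intervalIntegral.integral_same
      rw [h4, mul_zero, Real.exp_zero] at h3
      exact h3.mono_left nhdsWithin_le_nhds
    have h3 := ((hΩ.tendsto_one Θ hΘ).comp h1).mul h2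
    rw [mul_one] at h3
    refine h3.congr' ?_
    filter_upwards [self_mem_nhdsWithin] with t (ht : 0 < t)
    rw [hu_def]
    have := ht.ne'
    simp only [Function.comp]
    field_simp
  -- The uniqueness theorem covers `t < 1` only; the value at `1` follows by continuity from the
  -- left.
  have key : raySolution C f y 1 = u 1 := by
    have h1 : Tendsto u (𝓝[<] 1) (𝓝 (u 1)) := by
      have : ContinuousAt u 1 := ((continuousAt_id.mul (hΩd 1 one_pos le_rfl).continuousAt).mul
        ((hP 1).const_mul ((n : ℝ) - 1)⁻¹).exp.continuousAt)
      exact this.tendsto.mono_left nhdsWithin_le_nhds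
    have h2 : Tendsto u (𝓝[<] 1) (𝓝 (extend (raySolution C f y) 1)) := by
      refine (((continuous_extend (raySolution C f y)).tendsto 1).mono_left
        nhdsWithin_le_nhds).congr' ?_
      filter_upwards [Ioo_mem_nhdsLT (zero_lt_one' ℝ)] with t ht
        using extend_position_eq_of_ode hu hv hpos hlim ht
    rw [← tendsto_nhds_unique h2 h1]
    exact (extend_coe _ 1).symm
  rw [conformalExtension, key, hu_def]
  have h1 : primitive (expansionRay C y) 1 = P 1 := rfl
  simp only [h1, one_mul]
  rw [mul_assoc, ← Real.exp_add]
  simp [y]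

theorem primitive_expansionRay_smul (h : IsConeData k U C κ f) {y : Spacetime n} (hy : y ∈ U)
    {c : ℝ} (hc : c ∈ Set.Ioo (0 : ℝ) 1) :
    primitive (expansionRay C (c • y)) 1 = ∫ s in (0 : ℝ)..c, extend (expansionRay C y) s := by
  rw [primitive_apply]
  have h1 := intervalIntegral.mul_integral_comp_mul_left (a := 0) (b := 1)
    (f := extend (expansionRay C y)) c
  rw [mul_zero, mul_one] at h1
  rw [← h1, ← intervalIntegral.integral_const_mul]
  refine intervalIntegral.integral_congr fun t ht => ?_
  refine h.extend_expansionRay_smul hy hc ?_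
  simpa [Set.uIcc_of_le (zero_le_one' ℝ)] using ht

/-- The function `t ↦ φ_y(c t) / c` solves the equation attached to `c y` and is asymptotic to `t`
at `0`, so uniqueness applies. One solution thus describes the extension along a whole segment. -/
theorem raySolution_smul (h : IsConeData k U C κ f) {y : Spacetime n} (hy : y ∈ U)
    (hpos : ∀ t ∈ Set.Ioo (0 : ℝ) 1, 0 < extend (raySolution C f y) t) {c : ℝ}
    (hc : c ∈ Set.Ioo (0 : ℝ) 1) :
    raySolution C f (c • y) 1 = extend (raySolution C f y) c / c := by
  have hmem : ∀ t ∈ Set.Ioo (0 : ℝ) 1, c * t ∈ Set.Ioo (0 : ℝ) 1 := fun t ht =>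
    ⟨mul_pos hc.1 ht.1, mul_lt_one_of_nonneg_of_lt_one_left hc.1.le hc.2 ht.2.le⟩
  have hcomp : ∀ t : ℝ, HasDerivAt (fun t => c * t) c t := fun t => by
    simpa using (hasDerivAt_id t).const_mul c
  have key : ∀ t ∈ Set.Ioo (0 : ℝ) 1,
      extend (raySolution C f (c • y)) t = extend (raySolution C f y) (c * t) / c := by
    intro t ht
    refine extend_position_eq_of_ode (u := fun t => extend (raySolution C f y) (c * t) / c)
      (v := fun t => extend (rayVelocity C f y) (c * t)) (fun t ht => ?_) (fun t ht => ?_)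
      (fun t ht => div_pos (hpos _ (hmem t ht)) hc.1) ?_ ht
    · have h1 := ((hasDerivAt_position (rayQuotient f y) (focusingRay C y) (hmem t ht)).comp t
        (hcomp t)).div_const c
      rwa [mul_div_cancel_right₀ _ hc.1.ne'] at h1
    · have h1 := (hasDerivAt_velocity (rayQuotient f y) (focusingRay C y) (hmem t ht)).comp t
        (hcomp t)
      rw [h.extend_rayQuotient_smul hy hc (Set.Ioo_subset_Icc_self ht),
        h.extend_focusingRay_smul hy hc (Set.Ioo_subset_Icc_self ht)]
      convert! h1 using 1
      have := hc.1.ne'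
      simp only [raySolution, rayVelocity]
      field_simp
    · have h1 : Tendsto (fun t : ℝ => c * t) (𝓝[>] 0) (𝓝[>] 0) := by
        refine tendsto_nhdsWithin_iff.2 ⟨?_, ?_⟩
        · have := (hcomp 0).continuousAt.tendsto
          rw [mul_zero] at this
          exact this.mono_left nhdsWithin_le_nhds
        · filter_upwards [self_mem_nhdsWithin] with t ht using mul_pos hc.1 ht
      refine ((tendsto_position_div (rayQuotient f y) (focusingRay C y)).comp h1).congr fun t => ?_
      simp only [Function.comp, raySolution, div_div]
  have h1 : Tendsto (fun t => extend (raySolution C f y) (c * t) / c) (𝓝[<] 1)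
      (𝓝 (extend (raySolution C f y) (c * 1) / c)) :=
    ((((continuous_extend _).comp (continuous_const.mul continuous_id)).div_const c).tendsto
      1).mono_left nhdsWithin_le_nhds
  have h2 : Tendsto (fun t => extend (raySolution C f y) (c * t) / c) (𝓝[<] 1)
      (𝓝 (extend (raySolution C f (c • y)) 1)) := by
    refine (((continuous_extend (raySolution C f (c • y))).tendsto 1).mono_left
      nhdsWithin_le_nhds).congr' ?_
    filter_upwards [Ioo_mem_nhdsLT (zero_lt_one' ℝ)] with t ht using key t ht
  have h3 := tendsto_nhds_unique h2 h1
  rw [mul_one] at h3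
  rw [← h3]
  exact (extend_coe _ 1).symm

theorem conformalExtension_smul (h : IsConeData k U C κ f) {y : Spacetime n} (hy : y ∈ U)
    (hpos : ∀ t ∈ Set.Ioo (0 : ℝ) 1, 0 < extend (raySolution C f y) t) {c : ℝ}
    (hc : c ∈ Set.Ioo (0 : ℝ) 1) :
    conformalExtension C f (c • y) = extend (raySolution C f y) c / c
      * Real.exp (-((n : ℝ) - 1)⁻¹ * ∫ s in (0 : ℝ)..c, extend (expansionRay C y) s) := by
  rw [conformalExtension, h.raySolution_smul hy hpos hc, h.primitive_expansionRay_smul hy hc]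

theorem extend_raySolution_pos {y : Spacetime n} (hy : ‖rayVelocity C f y - 1‖ < 1) {t : ℝ}
    (ht : t ∈ Set.Ioc (0 : ℝ) 1) : 0 < extend (raySolution C f y) t := by
  have hpos : ∀ s : unitInterval, 0 < rayVelocity C f y s := fun s => by
    have h1 := ((rayVelocity C f y - 1).norm_coe_le_norm s).trans_lt hy
    rw [ContinuousMap.sub_apply, ContinuousMap.one_apply, Real.norm_eq_abs] at h1
    linarith [(abs_lt.1 h1).1]
  rw [raySolution, extend_position _ _ ⟨ht.1.le, ht.2⟩]
  exact intervalIntegral.intervalIntegral_pos_of_pos (intervalIntegrable_extend _ _ _)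
    (fun s => hpos _) ht.1

/-- The derivative of the conformal extension along a generator, and the divergence of the
rescaled metric. -/
theorem hasDerivAt_conformalExtension (h : IsConeData k U C κ f) {Θ : Fin n → ℝ} {ρ : ℝ}
    (hρ : 0 < ρ) (hy : conePoint ρ Θ ∈ U)
    (hpos : ∀ t ∈ Set.Ioo (0 : ℝ) 1, 0 < extend (raySolution C f (conePoint ρ Θ)) t) {r : ℝ}
    (hr : r ∈ Set.Ioo 0 ρ) :
    HasDerivAt (fun s => conformalExtension C f (conePoint s Θ))
      (conformalExtension C f (conePoint r Θ) *
        (extend (rayVelocity C f (conePoint ρ Θ)) (r / ρ)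
            / (ρ * extend (raySolution C f (conePoint ρ Θ)) (r / ρ)) - 1 / r
          - ((n : ℝ) - 1)⁻¹ * (logDeriv C (conePoint r Θ) (conePoint 1 Θ)).trace)) r := by
  have hmem : ∀ s ∈ Set.Ioo 0 ρ, s / ρ ∈ Set.Ioo (0 : ℝ) 1 := fun s hs =>
    ⟨div_pos hs.1 hρ, (div_lt_one hρ).2 hs.2⟩
  -- The extension at `conePoint s Θ` is defined by an equation depending on `s`; scaling reads all
  -- these values off the single solution with endpoint `conePoint ρ Θ`.
  have heq : ∀ s ∈ Set.Ioo 0 ρ, conformalExtension C f (conePoint s Θ)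
      = extend (raySolution C f (conePoint ρ Θ)) (s / ρ) / (s / ρ) * Real.exp (-((n : ℝ) - 1)⁻¹ *
        ∫ s in (0 : ℝ)..(s / ρ), extend (expansionRay C (conePoint ρ Θ)) s) := fun s hs => by
    rw [← h.conformalExtension_smul hy hpos (hmem s hs), ← conePoint_eq_smul,
      div_mul_cancel₀ _ hρ.ne']
  have hdiv : HasDerivAt (fun s : ℝ => s / ρ) (1 / ρ) r := (hasDerivAt_id r).div_const ρ
  have h1 := (((hasDerivAt_position (rayQuotient f (conePoint ρ Θ)) (focusingRay C (conePoint ρ Θ))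
    (hmem r hr)).comp r hdiv).fun_div hdiv (hmem r hr).1.ne').fun_mul
    (((hasDerivAt_integral_extend (expansionRay C (conePoint ρ Θ)) (r / ρ)).comp r hdiv).const_mul
      (-((n : ℝ) - 1)⁻¹)).exp
  have h2 := h1.congr_of_eventuallyEq (f₁ := fun s => conformalExtension C f (conePoint s Θ)) (by
    filter_upwards [isOpen_Ioo.mem_nhds hr] with s hs using heq s hs)
  convert! h2 using 1
  rw [heq r hr, h.extend_expansionRay_conePoint hy (hmem r hr), div_mul_cancel₀ _ hρ.ne']
  have h3 := (hpos _ (hmem r hr)).ne'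
  have h4 := hr.1.ne'
  have h5 := hρ.ne'
  simp only [Function.comp, raySolution, rayVelocity] at h3 ⊢
  field_simp
  ring

theorem isConformalFactor (h : IsConeData k U C κ f) {V : Set (Spacetime n)} (hV : IsOpen V)
    (hVU : V ⊆ U) (hVv : ∀ y ∈ V, ‖rayVelocity C f y - 1‖ < 1) :
    IsConformalFactor C κ V (conformalExtension C f) := by
  have hposV : ∀ y ∈ V, 0 < conformalExtension C f y := fun y hy => by
    have h1 := extend_raySolution_pos (hVv y hy) ⟨one_pos, le_rfl⟩
    have h2 := extend_coe (raySolution C f y) 1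
    rw [Set.Icc.coe_one] at h2
    rw [h2] at h1
    exact mul_pos h1 (Real.exp_pos _)
  have hpos : ∀ y ∈ V, ∀ t ∈ Set.Ioo (0 : ℝ) 1, 0 < extend (raySolution C f y) t :=
    fun y hy t ht => extend_raySolution_pos (hVv y hy) (Set.Ioo_subset_Ioc_self ht)
  -- Openness of `V` provides an endpoint beyond `r`, so that `r / ρ` is interior to `(0, 1)`, where
  -- the equation can be differentiated.
  have hext : ∀ (Θ : Fin n → ℝ) (r : ℝ), conePoint r Θ ∈ V →
      ∃ ρ, r < ρ ∧ conePoint ρ Θ ∈ V := fun Θ r hr => by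
    have h1 : ∀ᶠ s in 𝓝[>] r, conePoint s Θ ∈ V ∧ r < s :=
      ((continuous_conePoint.continuousAt.eventually (hV.mem_nhds hr)).filter_mono
        nhdsWithin_le_nhds).and self_mem_nhdsWithin
    obtain ⟨ρ, h2, h3⟩ := h1.exists
    exact ⟨ρ, h3, h2⟩
  refine ⟨fun y hy _ => hposV y hy.2, fun Θ _ => ?_, fun Θ _ r hr0 hr => ?_,
    fun Θ e he r hr0 hr => ?_⟩
  · have h1 : ContinuousAt (conformalExtension C f) (conePoint 0 Θ) := by
      rw [conePoint_eq_smul_one, zero_smul]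
      exact h.contDiffOn_conformalExtension.continuousOn.continuousAt
        (h.isOpen.mem_nhds h.zero_mem)
    have h2 := (ContinuousAt.comp (f := fun r => conePoint r Θ) h1
      continuous_conePoint.continuousAt).tendsto
    simp only [Function.comp] at h2
    rw [conePoint_eq_smul_one 0, zero_smul, h.conformalExtension_zero] at h2
    exact h2.mono_left nhdsWithin_le_nhds
  · obtain ⟨ρ, hρ, hρV⟩ := hext Θ r hr
    exact (h.hasDerivAt_conformalExtension (hr0.trans hρ) (hVU hρV) (hpos _ hρV)
      ⟨hr0, hρ⟩).differentiableAt
  · obtain ⟨ρ, hρ, hρV⟩ := hext Θ r hr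
    have hρ0 := hr0.trans hρ
    have hn := h.sub_one_ne_zero
    have hU := hVU hρV
    have hmem : ∀ s ∈ Set.Ioo 0 ρ, s / ρ ∈ Set.Ioo (0 : ℝ) 1 := fun s hs =>
      ⟨div_pos hs.1 hρ0, (div_lt_one hρ0).2 hs.2⟩
    have hτ : ∀ᶠ s in 𝓝 r, conePoint s Θ ∈ V ∧ s ∈ Set.Ioo 0 ρ :=
      (continuous_conePoint.continuousAt.eventually (hV.mem_nhds hr)).and
        (isOpen_Ioo.mem_nhds ⟨hr0, hρ⟩)
    -- The terms `1 / r` and `tr L` cancel, leaving `τ = (n - 1) φ' / (ρ φ)`.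
    have hτeq : divergence (rescaledMetric C (conformalExtension C f) Θ e) =ᶠ[𝓝 r] fun s =>
        ((n : ℝ) - 1) / ρ
          * (extend (rayVelocity C f (conePoint ρ Θ)) (s / ρ) / extend (raySolution C f (conePoint ρ Θ)) (s / ρ)) := by
      filter_upwards [hτ] with s hs
      rw [h.isGaussMetric.divergence_rescaledMetric h.two_le he hs.2.1.ne' (hVU hs.1)
        (h.hasDerivAt_conformalExtension hρ0 hU (hpos _ hρV) hs.2) (hposV _ hs.1).ne']
      have h1 := (hposV _ hs.1).ne'
      have h2 := (hpos _ hρV _ (hmem s hs.2)).ne'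
      have h3 := hs.2.1.ne'
      have h4 := hρ0.ne'
      rw [mul_div_cancel_left₀ _ h1]
      field_simp
      ring
    have hdiv : HasDerivAt (fun s : ℝ => s / ρ) (1 / ρ) r := (hasDerivAt_id r).div_const ρ
    have hr' := hmem r ⟨hr0, hρ⟩
    have h2 := (hpos _ hρV _ hr').ne'
    have hφ : HasDerivAt (fun s => extend (raySolution C f (conePoint ρ Θ)) (s / ρ))
        (extend (rayVelocity C f (conePoint ρ Θ)) (r / ρ) * (1 / ρ)) r :=
      (hasDerivAt_position _ _ hr').comp r hdiv
    have hχ : HasDerivAt (fun s => extend (rayVelocity C f (conePoint ρ Θ)) (s / ρ))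
        ((extend (rayQuotient f (conePoint ρ Θ)) (r / ρ)
            * extend (rayVelocity C f (conePoint ρ Θ)) (r / ρ)
          - extend (focusingRay C (conePoint ρ Θ)) (r / ρ)
            * extend (raySolution C f (conePoint ρ Θ)) (r / ρ)) * (1 / ρ)) r :=
      (hasDerivAt_velocity _ _ hr').comp r hdiv
    have h1 := ((hχ.fun_div hφ h2).const_mul (((n : ℝ) - 1) / ρ)).congr_of_eventuallyEq hτeq
    refine ⟨_, h1, ?_⟩
    rw [hτeq.self_of_nhds, h.extend_rayQuotient_conePoint he.unit hρ0 hU hr',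
      h.extend_focusingRay_conePoint he hρ0 hU hr', div_mul_cancel₀ _ hρ0.ne']
    have h4 := hρ0.ne'
    field_simp
    ring

/-- The velocity is identically `1` for `y = 0` and continuous in `y` for the sup norm, so it stays
within `1` of `1` on a small ball; there the solutions are positive. -/
theorem exists_isConformalFactor (h : IsConeData k U C κ f) :
    ∃ (V : Set (Spacetime n)) (Ω : Spacetime n → ℝ), IsOpen V ∧ 0 ∈ V ∧ StarConvex ℝ 0 V ∧
      V ⊆ U ∧ IsConformalFactor C κ V Ω := by
  have hcont : ContinuousAt (rayVelocity C f) 0 :=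
    h.contDiffOn_rayVelocity.continuousOn.continuousAt (h.isOpen.mem_nhds h.zero_mem)
  have h1 : ∀ᶠ y in 𝓝 (0 : Spacetime n), ‖rayVelocity C f y - 1‖ < 1 := by
    have h2 : Tendsto (fun y => ‖rayVelocity C f y - 1‖) (𝓝 0) (𝓝 0) := by
      have h3 := (hcont.sub (continuousAt_const (y := (1 : C(unitInterval, ℝ))))).norm.tendsto
      simpa [h.rayVelocity_zero] using h3
    exact h2.eventually (gt_mem_nhds one_pos)
  obtain ⟨δ, hδ, hball⟩ := Metric.mem_nhds_iff.1
    (Filter.inter_mem h1 (h.isOpen.mem_nhds h.zero_mem))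
  exact ⟨Metric.ball 0 δ, conformalExtension C f, Metric.isOpen_ball, Metric.mem_ball_self hδ,
    (convex_ball _ _).starConvex (Metric.mem_ball_self hδ), fun y hy => (hball hy).2,
    h.isConformalFactor Metric.isOpen_ball (fun y hy => (hball hy).2) fun y hy => (hball hy).1⟩

end IsConeData

end Data

end LightCone

end

theorem proposition3p1 (n : ℕ) (hn : 2 ≤ n) (k : ℕ∞)
    (U : Set (LightCone.Spacetime n)) (hU : IsOpen U) (h0U : (0 : LightCone.Spacetime n) ∈ U)
    (hUstar : StarConvex ℝ 0 U)
    (C : LightCone.TensorField n) (hC : LightCone.IsMetricOn (k + 1) C U)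
    (hnormal : LightCone.IsNormalOn C U)
    (κ f : LightCone.Spacetime n → ℝ) (hf : ContDiffOn ℝ k f U)
    (hf0 : f =O[𝓝 0] fun y => ‖y‖ ^ 2)
    (hκ : ∀ y ∈ LightCone.cone n ∩ U, y 0 * κ y = f y) :
    (∃ (V : Set (LightCone.Spacetime n)) (Ω : LightCone.Spacetime n → ℝ),
      IsOpen V ∧ 0 ∈ V ∧ StarConvex ℝ 0 V ∧ V ⊆ U ∧ LightCone.IsConformalFactor C κ V Ω) ∧
    ∀ V : Set (LightCone.Spacetime n), IsOpen V → 0 ∈ V → StarConvex ℝ 0 V → V ⊆ U →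
      ∀ Ω : LightCone.Spacetime n → ℝ, LightCone.IsConformalFactor C κ V Ω →
        (∃ F : LightCone.Spacetime n → ℝ, ContDiffOn ℝ k F V ∧ F 0 = 1 ∧
          ∀ y ∈ LightCone.cone n ∩ V, y ≠ 0 → Ω y ^ 2 = F y) ∧
        ∀ Ω' : LightCone.Spacetime n → ℝ, LightCone.IsConformalFactor C κ V Ω' →
          ∀ y ∈ LightCone.cone n ∩ V, y ≠ 0 → Ω' y = Ω y := by
  have h : LightCone.IsConeData k U C κ f :=
    ⟨hn, hU, h0U, hUstar, hC, hnormal, hf, hf0, hκ⟩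
  -- The function `F` depends neither on `V` nor on `Ω`. Regularity and uniqueness both follow from
  -- the agreement of every conformal factor with the extension.
  refine ⟨h.exists_isConformalFactor, fun V _ _ hVs hVU Ω hΩ => ⟨⟨fun y =>
    LightCone.conformalExtension C f y ^ 2, ?_, ?_, fun y hy hy0 => ?_⟩, fun Ω' hΩ' y hy hy0 => ?_⟩⟩
  · exact (h.contDiffOn_conformalExtension.mono hVU).pow 2
  · simp [h.conformalExtension_zero]
  · rw [h.eq_conformalExtension hVs hVU hΩ hy hy0]
  · rw [h.eq_conformalExtension hVs hVU hΩ hy hy0, h.eq_conformalExtension hVs hVU hΩ' hy hy0]
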